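/- **Setting.** Let $\ell^2=\ell^2(\mathbb N,\mathbb R)$ ("$\mathbb R^d$ with $d=\infty$"). A decentralized problem with local affine constraints over an undirected static graph $G$ on $\{1,\dots,n\}$ is $$\min_{x_1,\dots,x_n\in\ell^2}\ \sum_{i=1}^n f_i(x_i)\quad\text{s.t. } A_ix_i=b_i\ (i=1,\dots,n),\qquad x_1=\dots=x_n,$$ with $f_i:\ell^2\to\mathbb R$ differentiable, $A_i:\ell^2\to\ell^2$ bounded linear, $b_i\in\ell^2$; put $\mathbf A=\operatorname{diag}(A_1,\dots,A_n)$. A gossip matrix of $G$ is a symmetric positive semidefinite $W\in\mathbb R^{n\times n}$ such that $W_{ij}\ne0$ iff $ij$ is an edge or $i=j$, and $Wv=0$ iff $v_1=\dots=v_n$. By $\lambda_{\max}$ and $\lambda_{\min}^+$ we denote the largest and the smallest positive element of the spectrum. A first-order decentralized algorithm started at $x^0_1,\dots,x^0_n$ keeps local memories $\mathcal M_i$, with $\mathcal M_i(0)=\operatorname{span}\{x_i^0\}$. Each step is, for all agents $i$ in parallel, one of the following: * a local computation: add to $\mathcal M_i$ the span of all $\nabla f_i(x)$ and $\nabla f_i^*(x)$,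 $x\in\mathcal M_i$ ($f_i^*$ is the Fenchel conjugate); * a communication: add to $\mathcal M_i$ the memories $\mathcal M_j$ of all neighbours $j$ of $i$ in $G$; * a multiplication by $\mathbf A^\top\mathbf A$: add to $\mathcal M_i$ the span of $b_i$, $A_i^\top b_i$ and all $A_i^\top A_ix$, $x\in\mathcal M_i$. After every number $k$ of steps each agent outputs some $x_i^k\in\mathcal M_i(k)$. **Theorem.** For every $\kappa_0>1$ there is a constant $c>0$, depending only on $\kappa_0$, such that the following holds for all $\mu_F>0$, $L_F\ge\kappa_0\mu_F$, $\chi_W\ge1$ and $\chi_A\ge1$. There are $n$, a graph $G$ on $n$ nodes and a gossip matrix $W$ of $G$ with $\lambda_{\max}(W)/\lambda^+_{\min}(W)=\chi_W$ such that for all starting points $x_1^0,\dots,x_n^0\in\ell^2$ there is a problem as above, with all $f_i$ being $\mu_F$-strongly convex and $L_F$-smooth and with $\lambda_{\max}(\mathbf A^\top\mathbf A)/\lambda^+_{\min}(\mathbf A^\top\mathbf A)=\chi_A$, which has a solution $x_1=\dots=x_n=x^*$ and for which every first-order decentralized algorithm started at $x_1^0,\dots,x_n^0$ satisfies, for every $\varepsilon\in(0,1)$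 and every $k$: if $\|x_i^k-x^*\|^2\le\varepsilon$ for all $i$, then its first $k$ steps contain at least $$c\,N\ \text{local computations},\qquad c\,N\sqrt{\chi_W}\ \text{communications},\qquad c\,N\sqrt{\chi_A}\ \text{multiplications by }\mathbf A^\top\mathbf A,$$ where $N=\sqrt{L_F/\mu_F}\,\log(1/\varepsilon)$. In particular the graph, $W$ and the problem do not depend on $\varepsilon$. -/

import Mathlib

open scoped Matrix

/-- The real Hilbert space `ℓ²` of square-summable sequences, i.e. "`ℝ^d` with `d = ∞`". -/
abbrev SeqSpace : Type := lp (fun _ : ℕ => ℝ) 2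

section Convexity

variable {E : Type*} [NormedAddCommGroup E] [InnerProductSpace ℝ E] [CompleteSpace E]

/-- A differentiable function `f` is `μ`-strongly convex:
`f y ≥ f x + ⟪∇ f x, y - x⟫ + (μ / 2) ‖y - x‖²`. -/
def IsStronglyConvex (μ : ℝ) (f : E → ℝ) : Prop :=
  Differentiable ℝ f ∧
    ∀ x y : E, f x + inner ℝ (gradient f x) (y - x) + μ / 2 * ‖y - x‖ ^ 2 ≤ f y

/-- A differentiable function `f` is `L`-smooth:
`f y ≤ f x + ⟪∇ f x, y - x⟫ + (L / 2) ‖y - x‖²`. -/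
def IsLSmooth (L : ℝ) (f : E → ℝ) : Prop :=
  Differentiable ℝ f ∧
    ∀ x y : E, f y ≤ f x + inner ℝ (gradient f x) (y - x) + L / 2 * ‖y - x‖ ^ 2

/-- The Fenchel conjugate `f* y = sup_x (⟪y, x⟫ - f x)`. The supremum is finite for every `y`
when `f` is `μ`-strongly convex with `μ > 0`, the only case in which it is used. -/
noncomputable def fenchelConjugate (f : E → ℝ) (y : E) : ℝ :=
  ⨆ x : E, (inner ℝ y x - f x)

end Convexity

/-- `T` has a largest spectral value and a smallest positive spectral value, and their ratio
`λ_max(T) / λ_min⁺(T)` is `χ`. For a square matrix the spectrum is the set of eigenvalues. -/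
def HasConditionNumber {R : Type*} [Ring R] [Algebra ℝ R] (T : R) (χ : ℝ) : Prop :=
  ∃ lmax lmin : ℝ, IsGreatest (spectrum ℝ T) lmax ∧
    IsLeast {r : ℝ | r ∈ spectrum ℝ T ∧ 0 < r} lmin ∧ lmax / lmin = χ

/-- `W` is a gossip matrix of the undirected graph `G`. -/
structure IsGossipMatrix {n : ℕ} (G : SimpleGraph (Fin n)) (W : Matrix (Fin n) (Fin n) ℝ) :
    Prop where
  /-- symmetric and positive semi-definite -/
  posSemidef : W.PosSemidef
  /-- network compatibility -/
  compatible : ∀ i j : Fin n, W i j ≠ 0 ↔ (G.Adj i j ∨ i = j)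
  /-- kernel property -/
  kernel : ∀ v : Fin n → ℝ, W *ᵥ v = 0 ↔ ∀ i j : Fin n, v i = v j

/-- The data of the decentralized problem with local affine constraints
`min ∑ i, f i (x i)` subject to `A i (x i) = b i` for all `i` and `x 1 = ⋯ = x n`. -/
structure DecentralizedProblem (n : ℕ) where
  f : Fin n → SeqSpace → ℝ
  A : Fin n → SeqSpace →L[ℝ] SeqSpace
  b : Fin n → SeqSpace

namespace DecentralizedProblem

variable {n : ℕ} (P : DecentralizedProblem n)

/-- Feasibility: the local affine constraints and the consensus constraint. -/
def IsFeasible (x : Fin n → SeqSpace) : Prop :=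
  (∀ i, P.A i (x i) = P.b i) ∧ ∀ i j, x i = x j

/-- `x` solves the problem. -/
def IsSolution (x : Fin n → SeqSpace) : Prop :=
  P.IsFeasible x ∧ ∀ y : Fin n → SeqSpace, P.IsFeasible y → ∑ i, P.f i (x i) ≤ ∑ i, P.f i (y i)

/-- The block-diagonal operator `𝐀 = diag(A 1, …, A n)` on the Hilbert sum of `n` copies of the
space. -/
noncomputable def blockA :
    PiLp 2 (fun _ : Fin n => SeqSpace) →L[ℝ] PiLp 2 (fun _ : Fin n => SeqSpace) :=
  ((PiLp.continuousLinearEquiv 2 ℝ (fun _ : Fin n => SeqSpace)).symm :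
      (Fin n → SeqSpace) →L[ℝ] PiLp 2 (fun _ : Fin n => SeqSpace)) ∘L
    (ContinuousLinearMap.pi fun i => P.A i ∘L ContinuousLinearMap.proj i) ∘L
    ((PiLp.continuousLinearEquiv 2 ℝ (fun _ : Fin n => SeqSpace)) :
      PiLp 2 (fun _ : Fin n => SeqSpace) →L[ℝ] (Fin n → SeqSpace))

/-- The operator `𝐀ᵀ 𝐀`. -/
noncomputable def gramA :
    PiLp 2 (fun _ : Fin n => SeqSpace) →L[ℝ] PiLp 2 (fun _ : Fin n => SeqSpace) :=
  ContinuousLinearMap.adjoint P.blockA ∘L P.blockA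

end DecentralizedProblem

/-- The three kinds of step of a first-order decentralized algorithm. -/
inductive StepKind : Type
  | localComputation
  | communication
  | multiplication
  deriving DecidableEq

namespace DecentralizedProblem

variable {n : ℕ}

/-- The effect of one step on the local memories `M` of the agents. All agents act in parallel,
and everything an agent already holds is kept.
* local computation: agent `i` may evaluate `∇ f i` and `∇ (f i)*` at all points of its memory;
* communication: agent `i` receives the memories of its neighbours in `G`;
* matrix multiplication: agent `i` may apply `(A i)ᵀ (A i)` to all points of its memory, and gets
  access to `b i` and `(A i)ᵀ (b i)`. -/
noncomputable def stepMemory (P : DecentralizedProblem n) (G : SimpleGraph (Fin n)) :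
    StepKind → (Fin n → Submodule ℝ SeqSpace) → Fin n → Submodule ℝ SeqSpace
  | .localComputation, M, i =>
      M i ⊔ Submodule.span ℝ
        (gradient (P.f i) '' (M i) ∪ gradient (fenchelConjugate (P.f i)) '' (M i))
  | .communication, M, i =>
      M i ⊔ ⨆ (j : Fin n) (_ : G.Adj i j), M j
  | .multiplication, M, i =>
      M i ⊔ Submodule.span ℝ
        ({P.b i, ContinuousLinearMap.adjoint (P.A i) (P.b i)} ∪
          (fun x => ContinuousLinearMap.adjoint (P.A i) (P.A i x)) '' (M i))

/-- The local memories after `k` steps of an algorithm that starts at `x0` and whose `t`-th step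
(`t = 0, 1, …`) is of the kind `a t`. -/
noncomputable def memory (P : DecentralizedProblem n) (G : SimpleGraph (Fin n))
    (x0 : Fin n → SeqSpace) (a : ℕ → StepKind) : ℕ → Fin n → Submodule ℝ SeqSpace
  | 0 => fun i => Submodule.span ℝ {x0 i}
  | k + 1 => P.stepMemory G (a k) (P.memory G x0 a k)

/-- A run of a first-order decentralized algorithm on the problem `P` over the static graph `G`
from the starting points `x0`: the kinds of its steps and, after each number `k` of steps, an
approximate solution `x k i` chosen by each agent `i` from its memory. -/
structure AlgorithmRun (P : DecentralizedProblem n) (G : SimpleGraph (Fin n))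
    (x0 : Fin n → SeqSpace) where
  kind : ℕ → StepKind
  x : ℕ → Fin n → SeqSpace
  x_mem : ∀ (k : ℕ) (i : Fin n), x k i ∈ P.memory G x0 kind k i

/-- The number of steps of kind `s` among the first `k` steps of the run. -/
def AlgorithmRun.numSteps {P : DecentralizedProblem n} {G : SimpleGraph (Fin n)}
    {x0 : Fin n → SeqSpace} (R : P.AlgorithmRun G x0) (s : StepKind) (k : ℕ) : ℕ :=
  Nat.count (fun t => R.kind t = s) k

end DecentralizedProblem

/-! Give every agent the same constraint operator, acting on `m` orthogonal blocks of `ℓ²` as a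
matrix `D` with `Dᵀ * D = S`, where `S` is itself a gossip matrix of a second graph, on `m`
vertices. With `b = 0` the constraint says that the blocks of a vector agree, once its part outside
the blocks is disregarded, and multiplying by `AᵀA` is one round of communication between blocks.
The problem thus lives on the product of two networks, with places `(i, p)`.

The hard quadratic of Nesterov is spread over these places. Half of the path Laplacian on `ℕ` is the
sum of two projections, coupling the coordinates `2 l, 2 l + 1` and `2 l + 1, 2 l + 2` respectively
(`swapEven`, `swapOdd`). The first is put where both positions are `0`, the second where both are
maximal. The linear term feeds only coordinate `0`. To reach a further coordinate, information has
to use the two couplings alternately: each use is a local computation, and between uses it must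
cross the first graph (about `√χ_W` communications) and the second (about `√χ_A` multiplications).
`memory_le_vanishingSubmodule` makes this precise with thresholds, one choice of them for each kind
of step. Gradients of conjugates do not help, since the Hessian and its inverse are combinations of
the identity and one projection.

Each block of the solution is a geometric sequence with ratio `e^{-s}`, where `s` is at most of
order `√(μ/L)` (`geometricSeq_stationary`, `exists_rate`), so one missing coordinate already bounds
the error from below. The blocks are orthogonal to all starting points, which therefore carry no
information.

Graphs with exactly the prescribed condition number come from paths (`exists_gossip_matrix`),
followed by a doubling of the vertices that adds one freely chosen eigenvalue
(`spectrum_doubledMatrix`). -/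

/-! ### Eigenvalues of real matrices -/

section Spectrum

theorem Matrix.mem_spectrum_iff_exists_mulVec {V : Type*} [Fintype V] [DecidableEq V]
    {M : Matrix V V ℝ} {r : ℝ} : r ∈ spectrum ℝ M ↔ ∃ v, v ≠ 0 ∧ M *ᵥ v = r • v := by
  rw [spectrum.mem_iff, Matrix.isUnit_iff_isUnit_det, isUnit_iff_ne_zero, not_not,
    ← Matrix.exists_mulVec_eq_zero_iff]
  refine exists_congr fun v => and_congr_right fun _ => ?_
  rw [Matrix.sub_mulVec, sub_eq_zero, Algebra.algebraMap_eq_smul_one, Matrix.smul_mulVec,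
    Matrix.one_mulVec, eq_comm]

/-- A nonzero positive semidefinite matrix has a smallest positive eigenvalue. -/
theorem Matrix.PosSemidef.exists_isLeast_pos_spectrum {V : Type*} [Fintype V] [DecidableEq V]
    {M : Matrix V V ℝ} (hM : M.PosSemidef) (h0 : M ≠ 0) :
    ∃ l, IsLeast {r : ℝ | r ∈ spectrum ℝ M ∧ 0 < r} l := by
  have hfin : {r : ℝ | r ∈ spectrum ℝ M ∧ 0 < r}.Finite :=
    (Matrix.finite_spectrum M).subset fun r hr => hr.1
  have hne : {r : ℝ | r ∈ spectrum ℝ M ∧ 0 < r}.Nonempty := by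
    by_contra hemp
    apply h0
    rw [← hM.1.eigenvalues_eq_zero_iff]
    funext i
    refine le_antisymm ?_ (hM.eigenvalues_nonneg i)
    by_contra hlt
    exact hemp ⟨hM.1.eigenvalues i, hM.1.spectrum_real_eq_range_eigenvalues ▸ ⟨i, rfl⟩,
      not_le.mp hlt⟩
  obtain ⟨l, hl, hmin⟩ := Set.exists_min_image _ id hfin hne
  exact ⟨l, hl, fun r hr => hmin r hr⟩

end Spectrum

/-! ### Doubling a graph to prescribe the condition number exactly -/

section Doubling

variable {V : Type*} [Fintype V] [DecidableEq V]

/-- The matrix `L ⊗ Π₊ + T • (1 ⊗ Π₋)`, where `Π₊` and `Π₋` are the projections of the plane onto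
the two diagonals. -/
noncomputable def doubledMatrix (L : Matrix V V ℝ) (T : ℝ) : Matrix (V × Bool) (V × Bool) ℝ :=
  Matrix.of fun x y => L x.1 y.1 / 2 + if x.1 = y.1 then (if x.2 = y.2 then T / 2 else -(T / 2))
    else 0

theorem doubledMatrix_mulVec (L : Matrix V V ℝ) (T : ℝ) (v : V × Bool → ℝ) (i : V) (b : Bool) :
    (doubledMatrix L T *ᵥ v) (i, b) =
      (L *ᵥ fun j => v (j, true) + v (j, false)) i / 2 + T / 2 * (v (i, b) - v (i, !b)) := by
  simp only [doubledMatrix, Matrix.mulVec, dotProduct, Matrix.of_apply, Fintype.sum_prod_type,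
    Fintype.sum_bool]
  have h : ∀ j, (L i j / 2 + if i = j then (if b = true then T / 2 else -(T / 2)) else 0) *
        v (j, true) +
      (L i j / 2 + if i = j then (if b = false then T / 2 else -(T / 2)) else 0) * v (j, false) =
      L i j * (v (j, true) + v (j, false)) / 2 +
        if i = j then T / 2 * (v (j, b) - v (j, !b)) else 0 := by
    intro j
    by_cases hij : i = j <;> cases b <;> simp [hij] <;> ring
  rw [Finset.sum_congr rfl fun j _ => h j, Finset.sum_add_distrib, Finset.sum_div]
  simp

theorem doubledMatrix_posSemidef {L : Matrix V V ℝ} (hL : L.PosSemidef) {T : ℝ} (hT : 0 ≤ T) :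
    (doubledMatrix L T).PosSemidef := by
  refine Matrix.PosSemidef.of_dotProduct_mulVec_nonneg ?_ fun v => ?_
  · ext ⟨i, b⟩ ⟨j, b'⟩
    have := hL.1.apply i j
    simp only [star_trivial] at this
    simp [doubledMatrix, this, eq_comm]
  · have hLu := hL.dotProduct_mulVec_nonneg fun j => v (j, true) + v (j, false)
    simp only [star_trivial, dotProduct] at hLu
    simp only [star_trivial, dotProduct, Fintype.sum_prod_type, Fintype.sum_bool,
      doubledMatrix_mulVec, Bool.not_true, Bool.not_false]
    set Lu := L *ᵥ fun j => v (j, true) + v (j, false)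
    have h : ∀ i, v (i, true) * (Lu i / 2 + T / 2 * (v (i, true) - v (i, false))) +
        v (i, false) * (Lu i / 2 + T / 2 * (v (i, false) - v (i, true))) =
        (v (i, true) + v (i, false)) * Lu i / 2 + T / 2 * (v (i, true) - v (i, false)) ^ 2 := by
      intro i; ring
    rw [Finset.sum_congr rfl fun i _ => h i, Finset.sum_add_distrib, ← Finset.sum_div]
    have : 0 ≤ ∑ i, T / 2 * (v (i, true) - v (i, false)) ^ 2 :=
      Finset.sum_nonneg fun i _ => by positivity
    linarith

/-- Adding and subtracting the equations of the two copies of a vertex decouples the system: sums of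
the two copies see only `L`, differences see only `T`. -/
theorem doubledMatrix_mulVec_eq_smul_iff {L : Matrix V V ℝ} {T r : ℝ} {v : V × Bool → ℝ} :
    doubledMatrix L T *ᵥ v = r • v ↔
      L *ᵥ (fun j => v (j, true) + v (j, false)) = r • (fun j => v (j, true) + v (j, false)) ∧
        ∀ i, T * (v (i, true) - v (i, false)) = r * (v (i, true) - v (i, false)) := by
  constructor
  · intro h
    have h' : ∀ i b, (L *ᵥ fun j => v (j, true) + v (j, false)) i / 2 +
        T / 2 * (v (i, b) - v (i, !b)) = r * v (i, b) := fun i b => by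
      rw [← doubledMatrix_mulVec, h]; rfl
    refine ⟨funext fun i => ?_, fun i => ?_⟩
    · have h1 := h' i true
      have h2 := h' i false
      simp only [Bool.not_true, Bool.not_false] at h1 h2
      simp only [Pi.smul_apply, smul_eq_mul]
      linarith
    · have h1 := h' i true
      have h2 := h' i false
      simp only [Bool.not_true, Bool.not_false] at h1 h2
      linarith
  · rintro ⟨h1, h2⟩
    ext ⟨i, b⟩
    rw [doubledMatrix_mulVec, h1]
    have := h2 i
    cases b <;> simp only [Pi.smul_apply, smul_eq_mul, Bool.not_true, Bool.not_false] <;> linarith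

/-- An eigenvector either has a nonzero symmetric part, which is an eigenvector of `L`, or is
antisymmetric and belongs to `T`. Conversely, eigenvectors of `L` are copied, and the signs `±1` on
the two copies give `T`. -/
theorem spectrum_doubledMatrix [Nonempty V] (L : Matrix V V ℝ) (T : ℝ) :
    spectrum ℝ (doubledMatrix L T) = insert T (spectrum ℝ L) := by
  ext r
  rw [Set.mem_insert_iff, Matrix.mem_spectrum_iff_exists_mulVec,
    Matrix.mem_spectrum_iff_exists_mulVec]
  constructor
  · rintro ⟨v, hv, h⟩
    obtain ⟨h1, h2⟩ := doubledMatrix_mulVec_eq_smul_iff.mp h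
    by_cases hu : (fun j => v (j, true) + v (j, false)) = 0
    · left
      by_contra hr
      apply hv
      have hd : ∀ i, v (i, true) - v (i, false) = 0 := fun i => by
        have := h2 i
        have h3 : (T - r) * (v (i, true) - v (i, false)) = 0 := by linarith
        exact (mul_eq_zero.mp h3).resolve_left fun h4 => hr (by linarith)
      ext ⟨i, b⟩
      have h4 := congrFun hu i
      have h5 := hd i
      simp only [Pi.zero_apply] at h4
      cases b <;> simp only [Pi.zero_apply] <;> linarith
    · exact Or.inr ⟨_, hu, h1⟩
  · rintro (rfl | ⟨u, hu, h⟩)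
    · refine ⟨fun x => if x.2 then 1 else -1, ?_, ?_⟩
      · intro h0
        obtain ⟨i⟩ := ‹Nonempty V›
        simpa using congrFun h0 (i, true)
      · rw [doubledMatrix_mulVec_eq_smul_iff]
        refine ⟨?_, fun i => rfl⟩
        ext
        simp [Matrix.mulVec, dotProduct]
    · refine ⟨fun x => u x.1, fun h0 => hu ?_, ?_⟩
      · ext i; exact congrFun h0 (i, true)
      · rw [doubledMatrix_mulVec_eq_smul_iff]
        refine ⟨?_, fun i => by simp⟩
        have : (fun j => u j + u j) = (2 : ℝ) • u := by ext; simp [two_mul]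
        simp only [this, Matrix.mulVec_smul, h, smul_comm r (2 : ℝ) u]

end Doubling

/-- `pos` is a `1`-Lipschitz function on the vertices of `G` with values between `0` and `d`, and
each of the two extreme values is taken on the same fraction, at least a third, of all
vertices. -/
structure IsProfile {N : ℕ} (G : SimpleGraph (Fin N)) (d : ℕ) (pos : Fin N → ℕ) : Prop where
  one_le : 1 ≤ d
  le : ∀ i, pos i ≤ d
  adj : ∀ i j, G.Adj i j → pos i ≤ pos j + 1
  card_eq : (Finset.univ.filter fun i => pos i = 0).card =
    (Finset.univ.filter fun i => pos i = d).card
  card_le : N ≤ 3 * (Finset.univ.filter fun i => pos i = 0).card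
  card_pos : 0 < N

theorem hasConditionNumber_congr {R S : Type*} [Ring R] [Algebra ℝ R] [Ring S] [Algebra ℝ S]
    {a : R} {b : S} (h : spectrum ℝ a = spectrum ℝ b) {χ : ℝ} :
    HasConditionNumber a χ ↔ HasConditionNumber b χ := by
  simp only [HasConditionNumber, h]

/-- Any matrix with the kernel of a Laplacian and condition number at most `χ` gives rise to a
gossip matrix with condition number exactly `χ` on twice as many vertices. -/
theorem exists_gossip_of_laplacian {n d : ℕ} (L : Matrix (Fin n) (Fin n) ℝ) (pos : Fin n → ℕ)
    (hn : 2 ≤ n) (hL : L.PosSemidef) (hker : ∀ v : Fin n → ℝ, L *ᵥ v = 0 ↔ ∀ i j, v i = v j)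
    (hd : 1 ≤ d) (hpos : ∀ i, pos i ≤ d) (hadj : ∀ i j, L i j ≠ 0 → pos i ≤ pos j + 1)
    (hcard : (Finset.univ.filter fun i => pos i = 0).card =
      (Finset.univ.filter fun i => pos i = d).card)
    (hcard' : n ≤ 3 * (Finset.univ.filter fun i => pos i = 0).card)
    {χ : ℝ} (hχ : 1 ≤ χ)
    (hspec : ∀ r ∈ spectrum ℝ L, ∀ r' ∈ spectrum ℝ L, 0 < r' → r ≤ χ * r') :
    ∃ (N : ℕ) (G : SimpleGraph (Fin N)) (W : Matrix (Fin N) (Fin N) ℝ) (p : Fin N → ℕ),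
      IsGossipMatrix G W ∧ HasConditionNumber W χ ∧ IsProfile G d p := by
  have : Nonempty (Fin n) := ⟨⟨0, by omega⟩⟩
  have hL0 : L ≠ 0 := by
    rintro rfl
    have := (hker fun i => i.1).mp (by simp) ⟨0, by omega⟩ ⟨1, by omega⟩
    simp at this
  have hdiag : ∀ i, 0 ≤ L i i := fun i => hL.diag_nonneg
  obtain ⟨l, ⟨hlm, hl0⟩, hlmin⟩ := hL.exists_isLeast_pos_spectrum hL0
  -- By `hspec` this is the largest eigenvalue after doubling, while `l` stays the smallest positive
  -- one because `χ ≥ 1`; the quotient is exactly `χ`.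
  set T := χ * l with hT
  have hT0 : 0 < T := by positivity
  set M := doubledMatrix L T with hM
  have hMpsd : M.PosSemidef := doubledMatrix_posSemidef hL hT0.le
  have hMspec : spectrum ℝ M = insert T (spectrum ℝ L) := spectrum_doubledMatrix L T
  let e : Fin n × Bool ≃ Fin (Fintype.card (Fin n × Bool)) := Fintype.equivFin _
  let W := M.submatrix e.symm e.symm
  have hWs : ∀ i j, W i j = W j i := fun i j => by
    have := hMpsd.1.apply (e.symm j) (e.symm i)
    simpa [W] using this
  -- The graph is the off-diagonal support of `W`. It may join the two copies of a vertex, which is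
  -- harmless because positions ignore the copy.
  let G : SimpleGraph (Fin (Fintype.card (Fin n × Bool))) :=
    { Adj := fun i j => i ≠ j ∧ W i j ≠ 0
      symm := ⟨fun i j h => ⟨h.1.symm, by rw [hWs]; exact h.2⟩⟩
      loopless := ⟨fun i h => h.1 rfl⟩ }
  have hfilter : ∀ k, (Finset.univ.filter fun i => pos (e.symm i).1 = k).card =
      2 * (Finset.univ.filter fun i => pos i = k).card := fun k => by
    have h1 : (Finset.univ.filter fun i => pos (e.symm i).1 = k).card =
        (Finset.univ.filter fun x : Fin n × Bool => pos x.1 = k).card := by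
      refine Finset.card_equiv e.symm fun i => by simp
    have h2 : (Finset.univ.filter fun x : Fin n × Bool => pos x.1 = k) =
        (Finset.univ.filter fun i => pos i = k) ×ˢ (Finset.univ : Finset Bool) := by
      ext x; simp
    rw [h1, h2, Finset.card_product]
    simp [mul_comm]
  refine ⟨_, G, W, fun i => pos (e.symm i).1, ⟨hMpsd.submatrix _, ?_, ?_⟩, ?_, ?_⟩
  · intro i j
    by_cases hij : i = j
    · subst hij
      have := hdiag (e.symm i).1
      simp only [or_true, iff_true]
      simp only [W, M, doubledMatrix, Matrix.submatrix_apply, Matrix.of_apply, if_true]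
      positivity
    · simp [G, hij]
  · intro v
    have h1 : W *ᵥ v = 0 ↔ M *ᵥ (v ∘ e) = (0 : ℝ) • (v ∘ e) := by
      rw [Matrix.submatrix_mulVec_equiv, zero_smul]
      constructor
      · intro h
        ext x
        simpa using congrFun h (e x)
      · intro h
        rw [Equiv.symm_symm, h]; rfl
    rw [h1, doubledMatrix_mulVec_eq_smul_iff, zero_smul, hker]
    constructor
    · rintro ⟨h2, h3⟩
      have h4 : ∀ i b b', v (e (i, b)) = v (e (i, b')) := by
        intro i b b'
        have := h3 i
        simp only [Function.comp, zero_mul, mul_eq_zero, hT0.ne', false_or] at this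
        cases b <;> cases b' <;> linarith
      have h5 : ∀ x y, v (e x) = v (e y) := by
        rintro ⟨i, b⟩ ⟨j, b'⟩
        have h6 := h2 i j
        simp only [Function.comp] at h6
        rw [h4 i b true, h4 j b' true]
        rw [h4 i false true, h4 j false true] at h6
        linarith
      intro i j
      simpa using h5 (e.symm i) (e.symm j)
    · intro h
      refine ⟨fun i j => ?_, fun i => ?_⟩
      · simp only [Function.comp]
        rw [h (e (i, true)) (e (j, true)), h (e (i, false)) (e (j, false))]
      · simp only [Function.comp]
        rw [h (e (i, true)) (e (i, false))]; ring
  · have hWM : spectrum ℝ W = spectrum ℝ M :=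
      AlgEquiv.spectrum_eq (Matrix.reindexAlgEquiv ℝ ℝ e) M
    rw [hasConditionNumber_congr hWM]
    refine ⟨T, l, ⟨?_, ?_⟩, ⟨⟨?_, hl0⟩, ?_⟩, ?_⟩
    · rw [hMspec]; exact Set.mem_insert _ _
    · rw [hMspec]
      rintro r (rfl | hr)
      · exact le_rfl
      · exact hspec r hr l hlm hl0
    · rw [hMspec]; exact Or.inr hlm
    · rw [hMspec]
      rintro r ⟨rfl | hr, hr0⟩
      · nlinarith
      · exact hlmin ⟨hr, hr0⟩
    · rw [hT]; field_simp
  · refine ⟨hd, fun i => hpos _, ?_, ?_, ?_, ?_⟩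
    · rintro i j ⟨-, hij⟩
      by_cases h : (e.symm i).1 = (e.symm j).1
      · simp only [h]; omega
      · refine hadj _ _ fun h0 => hij ?_
        simp [W, M, doubledMatrix, h, h0]
    · rw [hfilter, hfilter, hcard]
    · rw [hfilter, Fintype.card_prod, Fintype.card_fin, Fintype.card_bool]; omega
    · rw [Fintype.card_prod, Fintype.card_fin, Fintype.card_bool]; omega

/-! ### Spectral bounds for paths, and the gossip matrices -/

section PathLaplacian

variable {m : ℕ}

theorem lapMatrix_pathGraph_quadratic_form [DecidableRel (SimpleGraph.pathGraph (m + 1)).Adj]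
    (v : Fin (m + 1) → ℝ) :
    v ⬝ᵥ ((SimpleGraph.pathGraph (m + 1)).lapMatrix ℝ *ᵥ v) =
      ∑ k : Fin m, (v k.succ - v k.castSucc) ^ 2 := by
  have h1 := SimpleGraph.lapMatrix_toLinearMap₂' ℝ (SimpleGraph.pathGraph (m + 1)) v
  rw [Matrix.toLinearMap₂'_apply'] at h1
  rw [h1]
  have h2 : ∀ i j : Fin (m + 1), (if (SimpleGraph.pathGraph (m + 1)).Adj i j then
      (v i - v j) ^ 2 else 0) = (if (i : ℕ) + 1 = j then (v j - v i) ^ 2 else 0) +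
        if (j : ℕ) + 1 = i then (v i - v j) ^ 2 else 0 := by
    intro i j
    simp only [SimpleGraph.pathGraph_adj]
    by_cases h : (i : ℕ) + 1 = j
    · have h' : ¬ (j : ℕ) + 1 = i := by omega
      simp only [h, h', if_true, if_false, true_or]; ring
    · simp [h]
  have h3 : ∑ i : Fin (m + 1), ∑ j : Fin (m + 1),
      (if (i : ℕ) + 1 = j then (v j - v i) ^ 2 else 0) =
        ∑ k : Fin m, (v k.succ - v k.castSucc) ^ 2 := by
    rw [Fin.sum_univ_castSucc]
    have hlast : ∑ j : Fin (m + 1), (if (Fin.last m : ℕ) + 1 = j then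
        (v j - v (Fin.last m)) ^ 2 else 0) = 0 := by
      refine Finset.sum_eq_zero fun j _ => if_neg ?_
      rw [Fin.val_last]; omega
    rw [hlast, add_zero]
    refine Finset.sum_congr rfl fun k _ => ?_
    rw [Finset.sum_eq_single k.succ]
    · simp
    · intro j _ hj
      refine if_neg fun h => hj ?_
      ext; simp at h ⊢; omega
    · simp
  simp only [h2, Finset.sum_add_distrib]
  rw [h3, Finset.sum_comm, h3]
  ring

/-- Telescoping along the path from `i` to `j` and the Cauchy–Schwarz inequality. -/
theorem sum_sq_sub_le_of_path (v : Fin (m + 1) → ℝ) (i j : Fin (m + 1)) :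
    (v i - v j) ^ 2 ≤ (m + 1) * ∑ k : Fin m, (v k.succ - v k.castSucc) ^ 2 := by
  wlog hij : i ≤ j generalizing i j
  · rw [← neg_sub, neg_sq]; exact this j i (le_of_not_ge hij)
  let u : ℕ → ℝ := fun k => if h : k < m + 1 then v ⟨k, h⟩ else 0
  have hu : ∀ i : Fin (m + 1), u i = v i := fun i => dif_pos i.2
  have hE : ∑ k : Fin m, (v k.succ - v k.castSucc) ^ 2 =
      ∑ k ∈ Finset.range m, (u (k + 1) - u k) ^ 2 := by
    rw [Finset.sum_range]
    refine Finset.sum_congr rfl fun k _ => ?_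
    rw [← hu, ← hu]; simp
  have h1 : u j - u i = ∑ k ∈ Finset.Ico (i : ℕ) j, (u (k + 1) - u k) := by
    rw [Finset.sum_Ico_sub _ hij]
  have h2 : Finset.Ico (i : ℕ) j ⊆ Finset.range m := fun k hk => by
    have := j.2
    simp at hk ⊢; omega
  rw [hE, ← hu, ← hu, ← neg_sub, neg_sq, h1]
  refine sq_sum_le_card_mul_sum_sq.trans ?_
  have h3 : ((Finset.Ico (i : ℕ) j).card : ℝ) ≤ m + 1 := by
    have := j.2
    have h4 : (Finset.Ico (i : ℕ) j).card ≤ m + 1 := by simp; omega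
    exact_mod_cast h4
  exact mul_le_mul h3 (Finset.sum_le_sum_of_subset_of_nonneg h2 fun _ _ _ => sq_nonneg _)
    (Finset.sum_nonneg fun _ _ => sq_nonneg _) (by positivity)

/-- The Poincaré inequality on a path. -/
theorem sum_sq_le_of_path (v : Fin (m + 1) → ℝ) (hv : ∑ i, v i = 0) :
    ∑ i, v i ^ 2 ≤ (m + 1) ^ 2 * ∑ k : Fin m, (v k.succ - v k.castSucc) ^ 2 := by
  set E := ∑ k : Fin m, (v k.succ - v k.castSucc) ^ 2 with hE
  have hE0 : 0 ≤ E := Finset.sum_nonneg fun _ _ => sq_nonneg _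
  -- For a vector of mean zero the cross terms vanish, so pairwise differences control the norm.
  have h1 : ∑ i, ∑ j, (v i - v j) ^ 2 = 2 * (m + 1) * ∑ i, v i ^ 2 := by
    have h : ∀ i, ∑ j, (v i - v j) ^ 2 =
        (m + 1) * v i ^ 2 - 2 * v i * ∑ j, v j + ∑ j, v j ^ 2 := by
      intro i
      simp only [sub_sq, Finset.sum_add_distrib, Finset.sum_sub_distrib, Finset.mul_sum]
      simp
    simp only [h, hv, mul_zero, sub_zero, Finset.sum_add_distrib, ← Finset.mul_sum]
    simp; ring
  have h2 : ∑ i, ∑ j, (v i - v j) ^ 2 ≤ ∑ _i : Fin (m + 1), ∑ _j : Fin (m + 1), (m + 1) * E :=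
    Finset.sum_le_sum fun i _ => Finset.sum_le_sum fun j _ => sum_sq_sub_le_of_path v i j
  rw [h1] at h2
  simp only [Finset.sum_const, Finset.card_univ, Fintype.card_fin, nsmul_eq_mul, Nat.cast_add,
    Nat.cast_one] at h2
  have hm : (0 : ℝ) < m + 1 := by positivity
  have h3 : 2 * ∑ i, v i ^ 2 ≤ (m + 1) ^ 2 * E := by
    refine le_of_mul_le_mul_left ?_ hm
    linarith
  have h4 : 0 ≤ ∑ i, v i ^ 2 := Finset.sum_nonneg fun _ _ => sq_nonneg _
  linarith

variable [DecidableRel (SimpleGraph.pathGraph (m + 1)).Adj]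

/-- An eigenvalue of the Laplacian of a path is given by a Rayleigh quotient. -/
theorem exists_eigenvector_lapMatrix_pathGraph {r : ℝ}
    (hr : r ∈ spectrum ℝ ((SimpleGraph.pathGraph (m + 1)).lapMatrix ℝ)) :
    ∃ v : Fin (m + 1) → ℝ, 0 < ∑ i, v i ^ 2 ∧
      ∑ k : Fin m, (v k.succ - v k.castSucc) ^ 2 = r * ∑ i, v i ^ 2 ∧
      (r ≠ 0 → ∑ i, v i = 0) := by
  obtain ⟨v, hv, h⟩ := Matrix.mem_spectrum_iff_exists_mulVec.mp hr
  refine ⟨v, ?_, ?_, fun hr0 => ?_⟩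
  · obtain ⟨i, hi⟩ := Function.ne_iff.mp hv
    exact Finset.sum_pos' (fun _ _ => sq_nonneg _) ⟨i, Finset.mem_univ _, by
      have : v i ≠ 0 := hi
      positivity⟩
  · rw [← lapMatrix_pathGraph_quadratic_form, h]
    simp only [dotProduct, Pi.smul_apply, smul_eq_mul, Finset.mul_sum]
    exact Finset.sum_congr rfl fun i _ => by ring
  · have h1 : (fun _ => (1 : ℝ)) ⬝ᵥ ((SimpleGraph.pathGraph (m + 1)).lapMatrix ℝ *ᵥ v) = 0 := by
      rw [Matrix.dotProduct_mulVec, ← Matrix.mulVec_transpose,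
        SimpleGraph.isSymm_lapMatrix, SimpleGraph.lapMatrix_mulVec_const_eq_zero, zero_dotProduct]
    rw [h] at h1
    simp only [dotProduct, one_mul, Pi.smul_apply, smul_eq_mul, ← Finset.mul_sum,
      mul_eq_zero] at h1
    exact h1.resolve_left hr0

theorem spectrum_lapMatrix_pathGraph_le {r : ℝ}
    (hr : r ∈ spectrum ℝ ((SimpleGraph.pathGraph (m + 1)).lapMatrix ℝ)) : r ≤ 4 := by
  obtain ⟨v, hv, h, -⟩ := exists_eigenvector_lapMatrix_pathGraph hr
  refine le_of_mul_le_mul_right ?_ hv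
  rw [← h]
  have h1 : ∑ k : Fin m, (v k.succ - v k.castSucc) ^ 2 ≤
      ∑ k : Fin m, (2 * v k.succ ^ 2 + 2 * v k.castSucc ^ 2) :=
    Finset.sum_le_sum fun k _ => by nlinarith [sq_nonneg (v k.succ + v k.castSucc)]
  rw [Finset.sum_add_distrib, ← Finset.mul_sum, ← Finset.mul_sum] at h1
  have h2 := Fin.sum_univ_succ fun i => v i ^ 2
  have h3 := Fin.sum_univ_castSucc fun i => v i ^ 2
  nlinarith [sq_nonneg (v 0), sq_nonneg (v (Fin.last m))]

theorem le_spectrum_lapMatrix_pathGraph {r : ℝ}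
    (hr : r ∈ spectrum ℝ ((SimpleGraph.pathGraph (m + 1)).lapMatrix ℝ)) (hr0 : 0 < r) :
    1 ≤ (m + 1) ^ 2 * r := by
  obtain ⟨v, hv, h, hsum⟩ := exists_eigenvector_lapMatrix_pathGraph hr
  have h1 := sum_sq_le_of_path v (hsum hr0.ne')
  rw [h, ← mul_assoc] at h1
  exact le_of_mul_le_mul_right (by simpa using h1) hv

theorem lapMatrix_pathGraph_mulVec_eq_zero (v : Fin (m + 1) → ℝ) :
    (SimpleGraph.pathGraph (m + 1)).lapMatrix ℝ *ᵥ v = 0 ↔ ∀ i j, v i = v j := by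
  rw [SimpleGraph.lapMatrix_mulVec_eq_zero_iff_forall_reachable]
  exact forall₂_congr fun i j => by simp [(SimpleGraph.pathGraph_connected m).preconnected i j]

end PathLaplacian

theorem pathGraph_adj_of_lapMatrix_ne_zero {n : ℕ} [DecidableRel (SimpleGraph.pathGraph n).Adj]
    {i j : Fin n}
    (h : (SimpleGraph.pathGraph n).lapMatrix ℝ i j ≠ 0) :
    (i : ℕ) ≤ j + 1 ∧ (j : ℕ) ≤ i + 1 := by
  by_cases hij : i = j
  · subst hij; omega
  · have : (SimpleGraph.pathGraph n).Adj i j := by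
      by_contra hadj
      apply h
      simp [SimpleGraph.lapMatrix, SimpleGraph.degMatrix, hij, SimpleGraph.adjMatrix_apply, hadj]
    rw [SimpleGraph.pathGraph_adj] at this
    omega

/-- For every `χ ≥ 1` there is a gossip matrix with condition number `χ` on a graph with two
large sets of vertices at a distance of order `√χ`. -/
theorem exists_gossip_matrix {χ : ℝ} (hχ : 1 ≤ χ) :
    ∃ (N : ℕ) (G : SimpleGraph (Fin N)) (W : Matrix (Fin N) (Fin N) ℝ) (d : ℕ) (p : Fin N → ℕ),
      IsGossipMatrix G W ∧ HasConditionNumber W χ ∧ IsProfile G d p ∧ Real.sqrt χ ≤ 16 * d := by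
  classical
  -- For small `χ` a single edge suffices: its only positive eigenvalue is `2`, and `√χ` is bounded
  -- by a constant.
  by_cases hχ64 : χ < 64
  · have hs : Real.sqrt χ ≤ 16 * (1 : ℕ) := by
      rw [Real.sqrt_le_left (by norm_num)]; norm_num; linarith
    have hr2 : ∀ r ∈ spectrum ℝ ((SimpleGraph.pathGraph (1 + 1)).lapMatrix ℝ), 0 < r → r = 2 := by
      intro r hr hr0
      obtain ⟨v, hv, h, hsum⟩ := exists_eigenvector_lapMatrix_pathGraph hr
      have h0 := hsum hr0.ne'
      simp only [Fin.sum_univ_succ, Finset.univ_unique, Finset.sum_singleton,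
        Fin.default_eq_zero, Fin.succ_zero_eq_one, Fin.castSucc_zero] at h h0 hv
      have h1 : v 1 = - v 0 := by linarith
      rw [h1] at h hv
      have h2 : 0 < v 0 ^ 2 := by nlinarith
      have h3 : (r - 2) * v 0 ^ 2 = 0 := by nlinarith
      have := (mul_eq_zero.mp h3).resolve_right h2.ne'
      linarith
    obtain ⟨N, G, W, p, h1, h2, h3⟩ := exists_gossip_of_laplacian (n := 1 + 1) (d := 1)
      ((SimpleGraph.pathGraph (1 + 1)).lapMatrix ℝ) (fun i => i) le_rfl
      (SimpleGraph.posSemidef_lapMatrix ℝ _) lapMatrix_pathGraph_mulVec_eq_zero le_rfl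
      (fun i => by omega) (fun i j h => (pathGraph_adj_of_lapMatrix_ne_zero h).1)
      (by decide) (by decide) hχ (fun r hr r' hr' h0 => by
        rw [hr2 r' hr' h0]
        rcases le_or_gt r 0 with h | h
        · linarith
        · rw [hr2 r hr h]; linarith)
    exact ⟨N, G, W, 1, p, h1, h2, h3, hs⟩
  · rw [not_lt] at hχ64
    -- With `8 d ≤ √χ` the path on `3 d + 1` vertices has condition number at most `4 (3 d + 1)² ≤
    -- 64 d² ≤ χ`. Rounding down costs at most a factor `2`, whence the `16` in the claim.
    set d := ⌊Real.sqrt χ / 8⌋₊ with hd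
    have h8 : 8 ≤ Real.sqrt χ := by
      exact Real.le_sqrt_of_sq_le (by linarith)
    have hd1 : 1 ≤ d := Nat.le_floor (by push_cast; linarith)
    have hle : (d : ℝ) ≤ Real.sqrt χ / 8 := Nat.floor_le (by positivity)
    have hlt : Real.sqrt χ / 8 < d + 1 := Nat.lt_floor_add_one _
    have hd1' : (1 : ℝ) ≤ d := by exact_mod_cast hd1
    have hsq : Real.sqrt χ ^ 2 = χ := Real.sq_sqrt (by linarith)
    -- The subtraction is truncated: the position is `0` on the first `d + 1` vertices, grows along
    -- the middle of the path and equals `d` on the last `d + 1`.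
    have h0 : (Finset.univ.filter fun i : Fin (3 * d + 1) => min ((i : ℕ) - d) d = 0) =
        Finset.Iic ⟨d, by omega⟩ := by
      ext i; simp [Fin.le_def]; omega
    obtain ⟨N, G, W, p, h1, h2, h3⟩ := exists_gossip_of_laplacian (n := 3 * d + 1) (d := d)
      ((SimpleGraph.pathGraph (3 * d + 1)).lapMatrix ℝ) (fun i => min (i - d) d) (by omega)
      (SimpleGraph.posSemidef_lapMatrix ℝ _) lapMatrix_pathGraph_mulVec_eq_zero hd1
      (fun i => by omega) (fun i j h => by
        have := pathGraph_adj_of_lapMatrix_ne_zero h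
        omega)
      (Finset.card_equiv Fin.revPerm fun i => by
        simp [Fin.val_rev]; omega)
      (by rw [h0, Fin.card_Iic]; simp only []; omega) hχ (fun r hr r' hr' h0 => by
        have h4 := spectrum_lapMatrix_pathGraph_le hr
        have h5 := le_spectrum_lapMatrix_pathGraph hr' h0
        push_cast at h5
        have h6 : (3 * (d : ℝ) + 1) ^ 2 * 4 ≤ χ := by nlinarith
        nlinarith)
    exact ⟨N, G, W, d, p, h1, h2, h3, by linarith⟩

/-! ### Quadratic functions and their conjugates -/

section Quadratic

variable {E : Type*} [NormedAddCommGroup E] [InnerProductSpace ℝ E]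

/-- The quadratic function `x ↦ ⟪B x, x⟫ / 2 - ⟪c, x⟫`. -/
noncomputable def quadratic (B : E →L[ℝ] E) (c x : E) : ℝ := inner ℝ (B x) x / 2 - inner ℝ c x

theorem quadratic_eq {B : E →L[ℝ] E} (hB : ∀ x y, inner ℝ (B x) y = inner ℝ x (B y)) (c x y : E) :
    quadratic B c y = quadratic B c x + inner ℝ (B x - c) (y - x) +
      inner ℝ (B (y - x)) (y - x) / 2 := by
  simp only [quadratic, map_sub, inner_sub_left, inner_sub_right]
  rw [hB y x, real_inner_comm (B x) y]
  ring

variable [CompleteSpace E]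

theorem hasGradientAt_quadratic {B : E →L[ℝ] E} (hB : ∀ x y, inner ℝ (B x) y = inner ℝ x (B y))
    (c x : E) : HasGradientAt (quadratic B c) (B x - c) x := by
  rw [hasGradientAt_iff_hasFDerivAt]
  have h1 : HasFDerivAt (fun y => inner ℝ (B y) y) _ x :=
    HasFDerivAt.inner ℝ B.hasFDerivAt (hasFDerivAt_id x)
  have h2 : HasFDerivAt (fun y => inner ℝ c y) (innerSL ℝ c) x := (innerSL ℝ c).hasFDerivAt
  have h3 := (h1.const_mul (1 / 2 : ℝ)).sub h2
  refine (h3.congr_of_eventuallyEq (.of_forall fun y => ?_)).congr_fderiv ?_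
  · simp [quadratic]; ring
  · ext y
    simp only [one_div, sub_apply, smul_apply,
      ContinuousLinearMap.comp_apply, ContinuousLinearMap.prod_apply, fderivInnerCLM_apply,
      innerSL_apply_apply, InnerProductSpace.toDual_apply_apply, inner_sub_left, smul_eq_mul,
      ContinuousLinearMap.id_apply]
    rw [hB y x, real_inner_comm (B x) y]
    ring

theorem gradient_quadratic {B : E →L[ℝ] E} (hB : ∀ x y, inner ℝ (B x) y = inner ℝ x (B y))
    (c x : E) : gradient (quadratic B c) x = B x - c :=
  (hasGradientAt_quadratic hB c x).gradient

theorem isStronglyConvex_quadratic {B : E →L[ℝ] E}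
    (hB : ∀ x y, inner ℝ (B x) y = inner ℝ x (B y)) (c : E) {μ : ℝ}
    (hμ : ∀ x, μ * ‖x‖ ^ 2 ≤ inner ℝ (B x) x) : IsStronglyConvex μ (quadratic B c) := by
  refine ⟨fun x => (hasGradientAt_quadratic hB c x).hasFDerivAt.differentiableAt, fun x y => ?_⟩
  rw [gradient_quadratic hB, quadratic_eq hB c x y]
  linarith [hμ (y - x)]

theorem isLSmooth_quadratic {B : E →L[ℝ] E}
    (hB : ∀ x y, inner ℝ (B x) y = inner ℝ x (B y)) (c : E) {L : ℝ}
    (hL : ∀ x, inner ℝ (B x) x ≤ L * ‖x‖ ^ 2) : IsLSmooth L (quadratic B c) := by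
  refine ⟨fun x => (hasGradientAt_quadratic hB c x).hasFDerivAt.differentiableAt, fun x y => ?_⟩
  rw [gradient_quadratic hB, quadratic_eq hB c x y]
  linarith [hL (y - x)]

/-- The conjugate of a convex quadratic function is a quadratic function. -/
theorem gradient_fenchelConjugate_quadratic {B C : E →L[ℝ] E}
    (hB : ∀ x y, inner ℝ (B x) y = inner ℝ x (B y))
    (hC : ∀ x y, inner ℝ (C x) y = inner ℝ x (C y)) (hBC : ∀ x, B (C x) = x)
    (hB0 : ∀ x, 0 ≤ inner ℝ (B x) x) (c y : E) :
    gradient (fenchelConjugate (quadratic B c)) y = C (y + c) := by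
  have hconj : fenchelConjugate (quadratic B c) =
      fun y => quadratic C (-C c) y + inner ℝ (C c) c / 2 := by
    funext y
    -- Completing the square around the maximiser `C (y + c)`.
    have hmax : ∀ x, inner ℝ y x - quadratic B c x =
        quadratic C (-C c) y + inner ℝ (C c) c / 2 -
          inner ℝ (B (x - C (y + c))) (x - C (y + c)) / 2 := by
      intro x
      have h1 : inner ℝ (B x) (C y) = inner ℝ x y := by rw [hB, hBC]
      have h2 : inner ℝ (B x) (C c) = inner ℝ x c := by rw [hB, hBC]
      have h3 : inner ℝ (C c) y = inner ℝ (C y) c := by rw [hC, real_inner_comm]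
      simp only [quadratic, map_sub, map_add, inner_sub_left, inner_sub_right, inner_add_left,
        inner_add_right, hBC, inner_neg_left, h1, h2]
      rw [real_inner_comm x y, real_inner_comm x c, real_inner_comm (C y) y,
        real_inner_comm (C c) y, real_inner_comm (C y) c, real_inner_comm (C c) c, h3]
      ring
    refine le_antisymm (ciSup_le fun x => ?_) ?_
    · rw [hmax]; linarith [hB0 (x - C (y + c))]
    · have hbdd : BddAbove (Set.range fun x => inner ℝ y x - quadratic B c x) := by
        refine ⟨quadratic C (-C c) y + inner ℝ (C c) c / 2, ?_⟩
        rintro _ ⟨x, rfl⟩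
        simp only [hmax]; linarith [hB0 (x - C (y + c))]
      refine le_trans (le_of_eq ?_) (le_ciSup hbdd (C (y + c)))
      simp only [hmax]; simp
  rw [hconj]
  have h := hasGradientAt_quadratic hC (-C c) y
  rw [hasGradientAt_iff_hasFDerivAt] at h
  have h' := h.add_const (inner ℝ (C c) c / 2)
  rw [← hasGradientAt_iff_hasFDerivAt] at h'
  rw [h'.gradient]; simp

end Quadratic

/-! ### Operators with two eigenvalues -/

section Projection

variable {E : Type*} [NormedAddCommGroup E] [InnerProductSpace ℝ E]

/-- `Q` is an orthogonal projection. -/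
structure IsOrthogonalProjection (Q : E →L[ℝ] E) : Prop where
  symm : ∀ x y, inner ℝ (Q x) y = inner ℝ x (Q y)
  idem : ∀ x, Q (Q x) = Q x

namespace IsOrthogonalProjection

variable {Q : E →L[ℝ] E}

theorem inner_eq (hQ : IsOrthogonalProjection Q) (x : E) : inner ℝ (Q x) x = ‖Q x‖ ^ 2 := by
  rw [← real_inner_self_eq_norm_sq, ← hQ.symm, hQ.idem]

theorem inner_le (hQ : IsOrthogonalProjection Q) (x : E) : inner ℝ (Q x) x ≤ ‖x‖ ^ 2 := by
  have h := real_inner_le_norm (Q x) x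
  rw [hQ.inner_eq] at h ⊢
  have h1 : ‖Q x‖ ≤ ‖x‖ := by
    by_contra hlt
    rw [not_le] at hlt
    nlinarith [norm_nonneg x, norm_nonneg (Q x)]
  exact pow_le_pow_left₀ (norm_nonneg _) h1 2

end IsOrthogonalProjection

/-- The self-adjoint operator with the eigenvalue `a` on the kernel and `b` on the range of the
projection `Q`. -/
noncomputable def twoValued (Q : E →L[ℝ] E) (a b : ℝ) : E →L[ℝ] E :=
  a • ContinuousLinearMap.id ℝ E + (b - a) • Q

theorem twoValued_apply (Q : E →L[ℝ] E) (a b : ℝ) (x : E) :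
    twoValued Q a b x = a • x + (b - a) • Q x := rfl

namespace IsOrthogonalProjection

variable {Q : E →L[ℝ] E}

theorem twoValued_symm (hQ : IsOrthogonalProjection Q) (a b : ℝ) (x y : E) :
    inner ℝ (twoValued Q a b x) y = inner ℝ x (twoValued Q a b y) := by
  simp only [twoValued_apply, inner_add_left, inner_add_right, real_inner_smul_left,
    real_inner_smul_right, hQ.symm]

/-- The inverse involves the same projection, so the gradient of the conjugate propagates
coordinates exactly as the gradient does. -/
theorem twoValued_inv (hQ : IsOrthogonalProjection Q) {a b : ℝ} (ha : a ≠ 0) (hb : b ≠ 0) (x : E) :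
    twoValued Q a b (twoValued Q a⁻¹ b⁻¹ x) = x := by
  simp only [twoValued_apply, map_add, map_smul, hQ.idem]
  match_scalars
  · field_simp
  · field_simp; ring

theorem le_inner_twoValued (hQ : IsOrthogonalProjection Q) {a b : ℝ} (hab : a ≤ b) (x : E) :
    a * ‖x‖ ^ 2 ≤ inner ℝ (twoValued Q a b x) x := by
  rw [twoValued_apply, inner_add_left, real_inner_smul_left, real_inner_smul_left,
    real_inner_self_eq_norm_sq, hQ.inner_eq]
  nlinarith [sq_nonneg ‖Q x‖]

theorem inner_twoValued_le (hQ : IsOrthogonalProjection Q) {a b : ℝ} (hab : a ≤ b) (x : E) :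
    inner ℝ (twoValued Q a b x) x ≤ b * ‖x‖ ^ 2 := by
  rw [twoValued_apply, inner_add_left, real_inner_smul_left, real_inner_smul_left,
    real_inner_self_eq_norm_sq]
  nlinarith [hQ.inner_le x]

end IsOrthogonalProjection

end Projection

/-! ### The two pairings of neighbouring coordinates -/

section HalfDifference

theorem memlp_comp_perm (σ : Equiv.Perm ℕ) (x : SeqSpace) :
    Memℓp (E := fun _ : ℕ => ℝ) (fun j => x (σ j)) 2 := by
  have h := lp.memℓp x
  rw [memℓp_gen_iff (by norm_num)] at h ⊢
  exact (Equiv.summable_iff σ).mpr h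

/-- The operator that permutes the coordinates of a sequence. -/
noncomputable def permuteCoords (σ : Equiv.Perm ℕ) : SeqSpace →L[ℝ] SeqSpace :=
  LinearMap.mkContinuous
    { toFun := fun x => ⟨fun j => x (σ j), memlp_comp_perm σ x⟩
      map_add' := fun _ _ => rfl
      map_smul' := fun _ _ => rfl } 1 fun x => by
    rw [one_mul, lp.norm_eq_tsum_rpow (by norm_num), lp.norm_eq_tsum_rpow (by norm_num)]
    exact le_of_eq (congrArg (· ^ _) (Equiv.tsum_eq σ fun j => ‖x j‖ ^ (2 : ENNReal).toReal))

theorem permuteCoords_apply (σ : Equiv.Perm ℕ) (x : SeqSpace) (j : ℕ) :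
    permuteCoords σ x j = x (σ j) := rfl

/-- The operator `x ↦ (x - x ∘ σ) / 2`. -/
noncomputable def halfDifference (σ : Equiv.Perm ℕ) : SeqSpace →L[ℝ] SeqSpace :=
  (1 / 2 : ℝ) • (ContinuousLinearMap.id ℝ SeqSpace - permuteCoords σ)

theorem halfDifference_apply (σ : Equiv.Perm ℕ) (x : SeqSpace) (j : ℕ) :
    halfDifference σ x j = (x j - x (σ j)) / 2 := by
  have : halfDifference σ x j = (1 / 2 : ℝ) * (x j - permuteCoords σ x j) := rfl
  rw [this, permuteCoords_apply]; ring

theorem isOrthogonalProjection_halfDifference {σ : Equiv.Perm ℕ} (hσ : ∀ j, σ (σ j) = j) :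
    IsOrthogonalProjection (halfDifference σ) := by
  constructor
  · intro x y
    have h : inner ℝ (permuteCoords σ x) y = inner ℝ x (permuteCoords σ y) := by
      rw [lp.inner_eq_tsum, lp.inner_eq_tsum, ← Equiv.tsum_eq σ]
      simp only [permuteCoords_apply, hσ]
    simp only [halfDifference, smul_apply, sub_apply,
      ContinuousLinearMap.id_apply, real_inner_smul_left, real_inner_smul_right, inner_sub_left,
      inner_sub_right, h]
  · intro x
    ext j
    simp only [halfDifference_apply, hσ]
    ring

/-- The involution `2 l ↔ 2 l + 1`. -/
def swapEven : Equiv.Perm ℕ :=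
  Function.Involutive.toPerm (fun j => if j % 2 = 0 then j + 1 else j - 1) fun j => by
    grind

/-- The involution `2 l + 1 ↔ 2 l + 2`, which fixes `0`. -/
def swapOdd : Equiv.Perm ℕ :=
  Function.Involutive.toPerm (fun j => if j = 0 then 0 else if j % 2 = 0 then j - 1 else j + 1)
    fun j => by grind

theorem swapEven_apply (j : ℕ) : swapEven j = if j % 2 = 0 then j + 1 else j - 1 := rfl

theorem swapOdd_apply (j : ℕ) :
    swapOdd j = if j = 0 then 0 else if j % 2 = 0 then j - 1 else j + 1 := rfl

theorem swapEven_swapEven (j : ℕ) : swapEven (swapEven j) = j := by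
  simp only [swapEven_apply]; grind

theorem swapOdd_swapOdd (j : ℕ) : swapOdd (swapOdd j) = j := by
  simp only [swapOdd_apply]; grind

end HalfDifference

/-! ### Orthogonal copies of `ℓ²` and matrices acting on them -/

section BlockSystem

variable {m : ℕ}

/-- `m` isometric embeddings `T p` of the sequence space into itself with orthogonal ranges, and
their adjoints `φ p`. -/
structure IsBlockSystem (T φ : Fin m → SeqSpace →L[ℝ] SeqSpace) : Prop where
  inner_eq : ∀ p x y, inner ℝ (T p x) y = inner ℝ x (φ p y)
  comp_eq : ∀ p q x, φ p (T q x) = if p = q then x else 0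

/-- In the orthogonal complement of finitely many vectors there is room for any number of
orthogonal copies of the sequence space. -/
theorem exists_isBlockSystem (m : ℕ) {n : ℕ} (x0 : Fin n → SeqSpace) :
    ∃ T φ : Fin m → SeqSpace →L[ℝ] SeqSpace, IsBlockSystem T φ ∧ ∀ p i, φ p (x0 i) = 0 := by
  classical
  have hsingle : ∀ (x : SeqSpace) (j : ℕ), x j = inner ℝ (lp.single 2 j (1 : ℝ) : SeqSpace) x := by
    intro x j
    rw [lp.inner_single_left]; simp
  have hinf : ¬ FiniteDimensional ℝ SeqSpace := by
    intro hfin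
    have hli : LinearIndependent ℝ fun j : ℕ => (lp.single 2 j (1 : ℝ) : SeqSpace) := by
      refine Orthonormal.linearIndependent ?_
      rw [orthonormal_iff_ite]
      intro i j
      rw [← hsingle, lp.single_apply]
      simp [Pi.single_apply]
    exact absurd hli.finite (not_finite_iff_infinite.mpr inferInstance)
  let V : Submodule ℝ SeqSpace := Submodule.span ℝ (Set.range x0)
  have : FiniteDimensional ℝ V := FiniteDimensional.span_of_finite ℝ (Set.finite_range x0)
  obtain ⟨w, b, hb⟩ := exists_hilbertBasis ℝ Vᗮ
  have hw : Infinite w := by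
    by_contra hfin
    rw [not_infinite_iff_finite] at hfin
    have : Fintype w := Fintype.ofFinite w
    have h1 : FiniteDimensional ℝ Vᗮ := b.toOrthonormalBasis.toBasis.finiteDimensional_of_finite
    apply hinf
    have h2 : FiniteDimensional ℝ (V ⊔ Vᗮ : Submodule ℝ SeqSpace) := inferInstance
    rw [Submodule.sup_orthogonal_of_hasOrthogonalProjection] at h2
    exact Module.Finite.equiv (Submodule.topEquiv (R := ℝ) (M := SeqSpace))
  -- An infinite orthonormal family in the complement of the starting points is split into `m`
  -- sequences, one for each block.
  obtain ⟨g⟩ : Nonempty (Fin m × ℕ ↪ w) :=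
    ⟨(Encodable.encode' (Fin m × ℕ)).trans (Infinite.natEmbedding w)⟩
  let e : Fin m × ℕ → SeqSpace := fun a => (b (g a) : SeqSpace)
  have he : Orthonormal ℝ e := by
    have h1 := b.orthonormal.comp g g.injective
    exact h1.comp_linearIsometry Vᗮ.subtypeₗᵢ
  have hep : ∀ p, Orthonormal ℝ fun j => e (p, j) := fun p =>
    he.comp _ fun i j h => (Prod.mk.inj h).2
  let T : Fin m → SeqSpace →ₗᵢ[ℝ] SeqSpace := fun p => (hep p).orthogonalFamily.linearIsometry
  have hT : ∀ p x, HasSum (fun j => x j • e (p, j)) (T p x) := fun p x =>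
    (hep p).orthogonalFamily.hasSum_linearIsometry x
  have hTs : ∀ p j, T p (lp.single 2 j (1 : ℝ)) = e (p, j) := fun p j =>
    ((hep p).orthogonalFamily.linearIsometry_apply_single (i := j) (1 : ℝ)).trans (by simp)
  let φ : Fin m → SeqSpace →L[ℝ] SeqSpace := fun p =>
    ContinuousLinearMap.adjoint (T p).toContinuousLinearMap
  have hφ : ∀ p x y, inner ℝ (T p x) y = inner ℝ x (φ p y) := fun p x y =>
    (ContinuousLinearMap.adjoint_inner_right (T p).toContinuousLinearMap x y).symm
  have hφj : ∀ p x j, φ p x j = inner ℝ (e (p, j)) x := fun p x j => by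
    rw [hsingle, ← hφ, hTs]
  refine ⟨fun p => (T p).toContinuousLinearMap, φ, ⟨hφ, fun p q x => ?_⟩, fun p i => ?_⟩
  · ext j
    rw [hφj]
    have h1 : HasSum (fun k => inner ℝ (e (p, j)) (x k • e (q, k))) (inner ℝ (e (p, j)) (T q x)) :=
      (hT q x).mapL (innerSL ℝ (e (p, j)))
    simp only [real_inner_smul_right, orthonormal_iff_ite.mp he, Prod.mk.injEq] at h1
    refine h1.unique ?_
    split_ifs with hpq
    · simp only [hpq, true_and, mul_ite, mul_one, mul_zero]
      convert hasSum_ite_eq j (x j) using 2 with k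
      by_cases hk : k = j
      · simp [hk]
      · simp [hk, Ne.symm hk]
    · simp only [hpq, false_and, if_false, mul_zero]
      exact hasSum_zero
  · ext j
    rw [hφj, real_inner_comm]
    exact (b (g (p, j))).2 _ (Submodule.subset_span ⟨i, rfl⟩)

namespace IsBlockSystem

variable {T φ : Fin m → SeqSpace →L[ℝ] SeqSpace}

theorem apply_sum (h : IsBlockSystem T φ) (y : Fin m → SeqSpace) (p : Fin m) :
    φ p (∑ q, T q (y q)) = y p := by
  simp [map_sum, h.comp_eq]

theorem norm_apply_le (h : IsBlockSystem T φ) (p : Fin m) (x : SeqSpace) : ‖φ p x‖ ≤ ‖x‖ := by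
  have h1 : ‖T p (φ p x)‖ ^ 2 = ‖φ p x‖ ^ 2 := by
    rw [← real_inner_self_eq_norm_sq, h.inner_eq, h.comp_eq, if_pos rfl,
      real_inner_self_eq_norm_sq]
  have h2 : ‖φ p x‖ ^ 2 = inner ℝ (T p (φ p x)) x := by
    rw [h.inner_eq, real_inner_self_eq_norm_sq]
  have h3 := real_inner_le_norm (T p (φ p x)) x
  have h4 : ‖T p (φ p x)‖ = ‖φ p x‖ := by
    rw [← abs_of_nonneg (norm_nonneg (T p _)), ← abs_of_nonneg (norm_nonneg (φ p x))]
    exact sq_eq_sq_iff_abs_eq_abs _ _ |>.mp h1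
  rw [← h2, h4] at h3
  by_contra hlt
  rw [not_le] at hlt
  nlinarith [norm_nonneg x, norm_nonneg (φ p x)]

theorem abs_coord_le (h : IsBlockSystem T φ) (p : Fin m) (x : SeqSpace) (j : ℕ) :
    |φ p x j| ≤ ‖x‖ :=
  (lp.norm_apply_le_norm (by norm_num) (φ p x) j).trans (h.norm_apply_le p x)

end IsBlockSystem

/-- The operator that acts on the blocks as the operators `q p` do. -/
noncomputable def blockDiagonal (T φ : Fin m → SeqSpace →L[ℝ] SeqSpace)
    (q : Fin m → SeqSpace →L[ℝ] SeqSpace) : SeqSpace →L[ℝ] SeqSpace :=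
  ∑ p, T p ∘L q p ∘L φ p

theorem blockDiagonal_apply (T φ q : Fin m → SeqSpace →L[ℝ] SeqSpace) (x : SeqSpace) :
    blockDiagonal T φ q x = ∑ p, T p (q p (φ p x)) := by
  simp [blockDiagonal]

theorem IsBlockSystem.isOrthogonalProjection_blockDiagonal
    {T φ q : Fin m → SeqSpace →L[ℝ] SeqSpace} (h : IsBlockSystem T φ)
    (hq : ∀ p, IsOrthogonalProjection (q p)) : IsOrthogonalProjection (blockDiagonal T φ q) := by
  constructor
  · intro x y
    simp only [blockDiagonal_apply, sum_inner, inner_sum]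
    refine Finset.sum_congr rfl fun p _ => ?_
    rw [h.inner_eq, (hq p).symm, real_inner_comm, ← h.inner_eq, real_inner_comm]
  · intro x
    rw [blockDiagonal_apply, blockDiagonal_apply]
    refine Finset.sum_congr rfl fun p _ => ?_
    rw [h.apply_sum, (hq p).idem]

/-- The operator that acts on the blocks as the matrix `D`. -/
noncomputable def blockMatrix (T φ : Fin m → SeqSpace →L[ℝ] SeqSpace)
    (D : Matrix (Fin m) (Fin m) ℝ) : SeqSpace →L[ℝ] SeqSpace :=
  ∑ p, T p ∘L ∑ q, D p q • φ q

theorem blockMatrix_apply (T φ : Fin m → SeqSpace →L[ℝ] SeqSpace)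
    (D : Matrix (Fin m) (Fin m) ℝ) (x : SeqSpace) :
    blockMatrix T φ D x = ∑ p, T p (∑ q, D p q • φ q x) := by
  simp [blockMatrix]

theorem blockMatrix_sub_apply (T φ : Fin m → SeqSpace →L[ℝ] SeqSpace)
    (D D' : Matrix (Fin m) (Fin m) ℝ) (x : SeqSpace) :
    blockMatrix T φ (D - D') x = blockMatrix T φ D x - blockMatrix T φ D' x := by
  simp only [blockMatrix_apply, ← Finset.sum_sub_distrib, ← map_sub, Matrix.sub_apply, sub_smul]

theorem blockMatrix_smul_apply (T φ : Fin m → SeqSpace →L[ℝ] SeqSpace) (r : ℝ)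
    (D : Matrix (Fin m) (Fin m) ℝ) (x : SeqSpace) :
    blockMatrix T φ (r • D) x = r • blockMatrix T φ D x := by
  simp only [blockMatrix_apply, Finset.smul_sum, ← map_smul, Matrix.smul_apply, smul_assoc]

namespace IsBlockSystem

variable {T φ : Fin m → SeqSpace →L[ℝ] SeqSpace}

theorem coord_blockMatrix (h : IsBlockSystem T φ) (D : Matrix (Fin m) (Fin m) ℝ) (p : Fin m)
    (x : SeqSpace) : φ p (blockMatrix T φ D x) = ∑ q, D p q • φ q x := by
  rw [blockMatrix_apply, h.apply_sum]

theorem blockMatrix_mul_apply (h : IsBlockSystem T φ) (D D' : Matrix (Fin m) (Fin m) ℝ)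
    (x : SeqSpace) : blockMatrix T φ (D * D') x = blockMatrix T φ D (blockMatrix T φ D' x) := by
  rw [blockMatrix_apply, blockMatrix_apply]
  refine Finset.sum_congr rfl fun p _ => congrArg _ ?_
  simp only [h.coord_blockMatrix, Matrix.mul_apply, Finset.sum_smul, Finset.smul_sum, smul_smul]
  exact Finset.sum_comm

theorem adjoint_blockMatrix (h : IsBlockSystem T φ) (D : Matrix (Fin m) (Fin m) ℝ) :
    ContinuousLinearMap.adjoint (blockMatrix T φ D) = blockMatrix T φ Dᵀ := by
  symm
  rw [ContinuousLinearMap.eq_adjoint_iff]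
  intro x y
  simp only [blockMatrix_apply, sum_inner, inner_sum, h.inner_eq, real_inner_smul_left, map_sum,
    map_smul, real_inner_smul_right, Matrix.transpose_apply]
  rw [Finset.sum_comm]
  refine Finset.sum_congr rfl fun p _ => Finset.sum_congr rfl fun q _ => ?_
  rw [real_inner_comm, ← h.inner_eq, real_inner_comm]

/-- The operator induced by a matrix has no spectral values other than `0` and those of the
matrix. -/
theorem bijective_sub_blockMatrix (h : IsBlockSystem T φ) {S : Matrix (Fin m) (Fin m) ℝ} {r : ℝ}
    (hr : r ∉ spectrum ℝ S) (hr0 : r ≠ 0) :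
    Function.Bijective fun x => r • x - blockMatrix T φ S x := by
  rw [spectrum.notMem_iff] at hr
  obtain ⟨u, hu⟩ := hr
  rw [Algebra.algebraMap_eq_smul_one] at hu
  have h1 : (r • 1 - S) * (↑u⁻¹ : Matrix (Fin m) (Fin m) ℝ) = 1 := by rw [← hu]; simp
  have h2 : (↑u⁻¹ : Matrix (Fin m) (Fin m) ℝ) * (r • 1 - S) = 1 := by rw [← hu]; simp
  set N : Matrix (Fin m) (Fin m) ℝ := ↑u⁻¹
  have hS1 : ∀ x, blockMatrix T φ S (blockMatrix T φ 1 x) = blockMatrix T φ S x := fun x => by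
    rw [← h.blockMatrix_mul_apply, mul_one]
  have h1S : ∀ x, blockMatrix T φ 1 (blockMatrix T φ S x) = blockMatrix T φ S x := fun x => by
    rw [← h.blockMatrix_mul_apply, one_mul]
  have e1 : ∀ x, blockMatrix T φ S (blockMatrix T φ N x) =
      r • blockMatrix T φ N x - blockMatrix T φ 1 x := fun x => by
    rw [← h.blockMatrix_mul_apply, ← blockMatrix_smul_apply, ← blockMatrix_sub_apply]
    congr 1
    rw [← h1]; simp [sub_mul]
  have e2 : ∀ x, blockMatrix T φ N (blockMatrix T φ S x) =
      r • blockMatrix T φ N x - blockMatrix T φ 1 x := fun x => by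
    rw [← h.blockMatrix_mul_apply, ← blockMatrix_smul_apply, ← blockMatrix_sub_apply]
    congr 1
    rw [← h2]; simp [mul_sub]
  -- `blockMatrix T φ 1` is only the projection onto the blocks. The inverse acts as the matrix
  -- resolvent there and as `r⁻¹` on the complement, which is where `r ≠ 0` enters.
  refine Function.bijective_iff_has_inverse.mpr
    ⟨fun x => blockMatrix T φ N x + r⁻¹ • (x - blockMatrix T φ 1 x), fun x => ?_, fun x => ?_⟩
  · simp only [map_sub, map_smul, e2, h1S]
    match_scalars <;> field_simp <;> ring
  · simp only [map_add, map_sub, map_smul, e1, hS1]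
    match_scalars <;> field_simp <;> ring

end IsBlockSystem

namespace DecentralizedProblem

variable {n : ℕ} (P : DecentralizedProblem n)

theorem blockA_apply (x : PiLp 2 fun _ : Fin n => SeqSpace) (i : Fin n) :
    P.blockA x i = P.A i (x i) := rfl

theorem gramA_apply (x : PiLp 2 fun _ : Fin n => SeqSpace) (i : Fin n) :
    P.gramA x i = ContinuousLinearMap.adjoint (P.A i) (P.A i (x i)) := by
  have h : P.gramA x = WithLp.toLp 2 fun i =>
      ContinuousLinearMap.adjoint (P.A i) (P.A i (x i)) := by
    refine ext_inner_right ℝ fun y => ?_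
    rw [gramA, ContinuousLinearMap.comp_apply, ContinuousLinearMap.adjoint_inner_left,
      PiLp.inner_apply, PiLp.inner_apply]
    simp only [blockA_apply, ContinuousLinearMap.adjoint_inner_left]
  rw [h]

/-- If all agents have the same block matrix as constraint operator, the Gram operator of the
problem has the same spectrum as the Gram matrix. -/
theorem spectrum_gramA {T φ : Fin m → SeqSpace →L[ℝ] SeqSpace} (h : IsBlockSystem T φ)
    (hn : 0 < n) {D S : Matrix (Fin m) (Fin m) ℝ} (hS : Dᵀ * D = S)
    (h0 : (0 : ℝ) ∈ spectrum ℝ S) (hA : ∀ i, P.A i = blockMatrix T φ D) :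
    spectrum ℝ P.gramA = spectrum ℝ S := by
  have hG : ∀ x i, P.gramA x i = blockMatrix T φ S (x i) := fun x i => by
    rw [gramA_apply, hA, h.adjoint_blockMatrix, ← h.blockMatrix_mul_apply, hS]
  have hcoord : ∀ (r : ℝ) x i, (algebraMap ℝ _ r - P.gramA) x i =
      r • x i - blockMatrix T φ S (x i) := fun r x i => by
    rw [← hG, Algebra.algebraMap_eq_smul_one]; rfl
  ext r
  constructor
  · intro hr
    by_contra hrS
    have hr0 : r ≠ 0 := by rintro rfl; exact hrS h0
    have hbij := h.bijective_sub_blockMatrix hrS hr0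
    apply hr
    rw [spectrum.mem_resolventSet_iff, ContinuousLinearMap.isUnit_iff_bijective]
    constructor
    · intro x y hxy
      ext1 i
      apply hbij.1
      simp only [← hcoord, hxy]
    · intro y
      choose x hx using fun i => hbij.2 (y i)
      refine ⟨WithLp.toLp 2 x, ?_⟩
      ext1 i
      rw [hcoord]; exact hx i
  · intro hr hunit
    obtain ⟨v, hv, hSv⟩ := Matrix.mem_spectrum_iff_exists_mulVec.mp hr
    rw [spectrum.mem_resolventSet_iff, ContinuousLinearMap.isUnit_iff_bijective] at hunit
    -- An eigenvector of the matrix, placed in coordinate `0` of the blocks and given to all agents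
    -- alike.
    let y : Fin m → SeqSpace := fun p => v p • lp.single 2 0 (1 : ℝ)
    have h1 : r • (∑ p, T p (y p)) - blockMatrix T φ S (∑ p, T p (y p)) = 0 := by
      rw [blockMatrix_apply, Finset.smul_sum, ← Finset.sum_sub_distrib]
      refine Finset.sum_eq_zero fun p _ => ?_
      have h2 := congrFun hSv p
      simp only [Matrix.mulVec, dotProduct, Pi.smul_apply, smul_eq_mul] at h2
      simp only [h.apply_sum]
      simp only [y, smul_smul, ← Finset.sum_smul, h2, map_smul, sub_self]
    have h3 : (WithLp.toLp 2 fun _ => ∑ p, T p (y p) : PiLp 2 fun _ : Fin n => SeqSpace) = 0 := by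
      apply hunit.1
      rw [map_zero]
      ext1 i
      rw [hcoord]; exact h1
    have h4 : ∑ p, T p (y p) = 0 := congrArg (fun z => z.ofLp ⟨0, hn⟩) h3
    apply hv
    ext p
    have h5 : y p = 0 := by rw [← h.apply_sum y p, h4, map_zero]
    have h6 : (v p • (lp.single 2 0 (1 : ℝ) : SeqSpace)) 0 = 0 := by
      change (y p) 0 = 0
      rw [h5]; rfl
    simpa using h6

end DecentralizedProblem

end BlockSystem

/-! ### How fast coordinates enter the memories -/

section Propagation

variable {n m : ℕ}

/-- The problem with the objectives `μ / 2 ‖x‖² + (L - μ) / 2 ‖Q i x‖² - ⟪c, x⟫`, where the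
projection `Q i` acts on the `p`-th block as `q i p`, and with the constraint operators `D`. -/
noncomputable def blockProblem (T φ : Fin m → SeqSpace →L[ℝ] SeqSpace)
    (q : Fin n → Fin m → SeqSpace →L[ℝ] SeqSpace) (D : Matrix (Fin m) (Fin m) ℝ) (μ L c : ℝ) :
    DecentralizedProblem n where
  f i := quadratic (twoValued (blockDiagonal T φ (q i)) μ L) (∑ p, T p (lp.single 2 0 c))
  A _ := blockMatrix T φ D
  b _ := 0

/-- The vectors whose `j`-th coordinate in the `p`-th block vanishes if `K < τ p j`. -/
def vanishingSubmodule (φ : Fin m → SeqSpace →L[ℝ] SeqSpace) (τ : Fin m → ℕ → ℕ) (K : ℕ) :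
    Submodule ℝ SeqSpace where
  carrier := {x | ∀ p j, K < τ p j → φ p x j = 0}
  add_mem' {x y} hx hy p j h := by
    rw [map_add, lp.coeFn_add, Pi.add_apply, hx p j h, hy p j h, add_zero]
  zero_mem' p j _ := by rw [map_zero]; rfl
  smul_mem' r x hx p j h := by
    rw [map_smul, lp.coeFn_smul, Pi.smul_apply, hx p j h, smul_zero]

theorem vanishingSubmodule_mono {φ : Fin m → SeqSpace →L[ℝ] SeqSpace} {τ τ' : Fin m → ℕ → ℕ}
    {K K' : ℕ} (h : ∀ p j, K' < τ' p j → K < τ p j) :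
    vanishingSubmodule φ τ K ≤ vanishingSubmodule φ τ' K' :=
  fun _ hx p j hj => hx p j (h p j hj)

variable {T φ : Fin m → SeqSpace →L[ℝ] SeqSpace}
  {q : Fin n → Fin m → SeqSpace →L[ℝ] SeqSpace}

/-- The values `a` and `b` are arbitrary, so this serves both the Hessian and its inverse. The
allowance `w` is `1` when local computations are being counted and `0` otherwise. -/
theorem twoValued_blockDiagonal_mem (h : IsBlockSystem T φ) {τ : Fin m → ℕ → ℕ} {K w : ℕ}
    {i : Fin n} (hq : ∀ p (u : SeqSpace), (∀ j, K < τ p j → u j = 0) →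
      ∀ j, K + w < τ p j → q i p u j = 0) (a b : ℝ) {x : SeqSpace}
    (hx : x ∈ vanishingSubmodule φ τ K) :
    twoValued (blockDiagonal T φ (q i)) a b x ∈ vanishingSubmodule φ τ (K + w) := by
  rw [twoValued_apply]
  refine add_mem (Submodule.smul_mem _ _ (vanishingSubmodule_mono (fun p j hj => by omega) hx))
    (Submodule.smul_mem _ _ fun p j hj => ?_)
  rw [blockDiagonal_apply, h.apply_sum]
  exact hq p _ (fun j hj => hx p j hj) j hj

/-- If the thresholds `τ i p j` grow by at most one in every step of the kind `s` and do not grow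
in the other steps, then the `j`-th coordinate of the `p`-th block is not available to the agent
`i` before the number of steps of the kind `s` has reached `τ i p j`. -/
theorem memory_le_vanishingSubmodule (h : IsBlockSystem T φ) {G : SimpleGraph (Fin n)}
    {D S : Matrix (Fin m) (Fin m) ℝ} (hS : Dᵀ * D = S) {μ L c : ℝ} (hμ : 0 < μ) (hμL : μ ≤ L)
    (hq : ∀ i p, IsOrthogonalProjection (q i p)) {x0 : Fin n → SeqSpace}
    (hx0 : ∀ p i, φ p (x0 i) = 0) (s : StepKind) (w : StepKind → ℕ)
    (hw : ∀ s', w s' = if s' = s then 1 else 0) (τ : Fin n → Fin m → ℕ → ℕ)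
    (hτ0 : ∀ i p, τ i p 0 = 0)
    (hlocal : ∀ i p (u : SeqSpace) K, (∀ j, K < τ i p j → u j = 0) →
      ∀ j, K + w .localComputation < τ i p j → q i p u j = 0)
    (hcomm : ∀ i i' p j, G.Adj i i' → τ i p j ≤ τ i' p j + w .communication)
    (hmult : ∀ i p p' j, S p p' ≠ 0 → τ i p j ≤ τ i p' j + w .multiplication)
    (a : ℕ → StepKind) (k : ℕ) (i : Fin n) :
    (blockProblem T φ q D μ L c).memory G x0 a k i ≤
      vanishingSubmodule φ (τ i) (Nat.count (fun t => a t = s) k) := by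
  induction k generalizing i with
  | zero =>
    simp only [DecentralizedProblem.memory, Submodule.span_le, Set.singleton_subset_iff]
    intro p j _
    rw [hx0]; rfl
  | succ k ih =>
    rw [Nat.count_succ, ← hw]
    set K := Nat.count (fun t => a t = s) k
    have hold : ∀ i w', vanishingSubmodule φ (τ i) K ≤ vanishingSubmodule φ (τ i) (K + w') :=
      fun i w' => vanishingSubmodule_mono fun p j hj => by omega
    rw [DecentralizedProblem.memory]
    cases a k with
    | localComputation =>
      refine sup_le ((ih i).trans (hold i _)) (Submodule.span_le.mpr ?_)
      have hQ := h.isOrthogonalProjection_blockDiagonal (hq i)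
      have hL : 0 < L := hμ.trans_le hμL
      -- The linear term lives in coordinate `0`, whose threshold is `0`.
      have hc : ∀ K, (∑ p, T p (lp.single 2 0 c)) ∈ vanishingSubmodule φ (τ i) K := by
        intro K p j hj
        rw [h.apply_sum, lp.single_apply_ne]
        rintro rfl
        rw [hτ0] at hj; omega
      have hmem := fun a b x hx => twoValued_blockDiagonal_mem (K := K) (x := x) h
        (fun p u => hlocal i p u K) a b hx
      rintro _ (⟨x, hx, rfl⟩ | ⟨x, hx, rfl⟩)
      · change gradient (quadratic _ _) x ∈ _
        rw [gradient_quadratic (hQ.twoValued_symm μ L)]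
        exact sub_mem (hmem _ _ _ (ih i hx)) (hc _)
      · change gradient (fenchelConjugate (quadratic _ _)) x ∈ _
        rw [gradient_fenchelConjugate_quadratic (hQ.twoValued_symm μ L)
          (hQ.twoValued_symm μ⁻¹ L⁻¹) (hQ.twoValued_inv hμ.ne' hL.ne')
          (fun x => le_trans (by positivity) (hQ.le_inner_twoValued hμL x))]
        exact hmem _ _ _ (add_mem (ih i hx) (hc _))
    | communication =>
      refine sup_le ((ih i).trans (hold i _)) (iSup₂_le fun i' hi' => (ih i').trans ?_)
      refine vanishingSubmodule_mono fun p j hj => ?_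
      have := hcomm i i' p j hi'
      omega
    | multiplication =>
      refine sup_le ((ih i).trans (hold i _)) (Submodule.span_le.mpr ?_)
      rintro _ (hb | ⟨x, hx, rfl⟩)
      · have : ∀ y ∈ ({(blockProblem T φ q D μ L c).b i, ContinuousLinearMap.adjoint
            ((blockProblem T φ q D μ L c).A i) ((blockProblem T φ q D μ L c).b i)} :
              Set SeqSpace), y = 0 := by
          simp [blockProblem]
        rw [this _ hb]
        exact Submodule.zero_mem _
      · intro p j hj
        change φ p (ContinuousLinearMap.adjoint (blockMatrix T φ D) (blockMatrix T φ D x)) j = 0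
        -- Only the product `Dᵀ * D = S` is ever applied, so the sparsity of `S` matters and that of
        -- `D` does not.
        rw [h.adjoint_blockMatrix, ← h.blockMatrix_mul_apply, hS, h.coord_blockMatrix,
          lp.coeFn_sum, Finset.sum_apply]
        refine Finset.sum_eq_zero fun p' _ => ?_
        rw [lp.coeFn_smul, Pi.smul_apply, smul_eq_mul]
        by_cases hp : S p p' = 0
        · rw [hp, zero_mul]
        · rw [ih i hx p' j (by have := hmult i p p' j hp; omega), mul_zero]

end Propagation

/-! ### Thresholds for travelling to and fro, and the couplings -/

section Levels

/-- The number of moves from a place with position `0` to a place with position `d` and back that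
are needed until the `j`-th coordinate can appear at a place with position `π`. -/
def levelThreshold (d π j : ℕ) : ℕ :=
  if j = 0 then 0 else if j % 2 = 0 then j * d - π else (j - 1) * d + π

theorem levelThreshold_le_add_one {d π π' : ℕ} (h : π ≤ π' + 1) (h' : π' ≤ π + 1) (j : ℕ) :
    levelThreshold d π j ≤ levelThreshold d π' j + 1 := by
  simp only [levelThreshold]
  split_ifs <;> omega

theorem le_levelThreshold {d π : ℕ} (h : π ≤ d) (j : ℕ) :
    (j - 1) * d ≤ levelThreshold d π j := by
  simp only [levelThreshold]
  obtain rfl | ⟨j, rfl⟩ : j = 0 ∨ ∃ i, j = i + 1 := by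
    cases j <;> simp
  · simp
  · simp only [Nat.add_sub_cancel, Nat.succ_ne_zero, if_false, add_mul, one_mul]
    split_ifs <;> omega

/-- At position `0` the coordinates `2 l` and `2 l + 1` both have threshold `2 l d`, so the coupling
located there gains nothing however often it is used. -/
theorem levelThreshold_swapEven (d j : ℕ) :
    levelThreshold d 0 (swapEven j) = levelThreshold d 0 j := by
  rw [swapEven_apply]
  simp only [levelThreshold]
  obtain ⟨l, rfl | rfl⟩ := Nat.even_or_odd' j
  · rcases l with _ | l
    · simp
    · simp
  · rcases l with _ | l
    · simp
    · simp

/-- At position `d` the coordinates `2 l + 1` and `2 l + 2` both have threshold `(2 l + 1) d`. -/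
theorem levelThreshold_swapOdd (d j : ℕ) :
    levelThreshold d d (swapOdd j) = levelThreshold d d j := by
  rw [swapOdd_apply]
  simp only [levelThreshold]
  obtain ⟨l, rfl | rfl⟩ := Nat.even_or_odd' j
  · rcases l with _ | l
    · simp
    · have h1 : (2 * (l + 1) - 1) % 2 ≠ 0 := by omega
      have h2 : 2 * (l + 1) - 1 - 1 = 2 * l := by omega
      have h3 : 2 * (l + 1) - 1 ≠ 0 := by omega
      simp only [h1, h2, h3, if_false, Nat.mul_mod_right, if_true, mul_eq_zero, OfNat.ofNat_ne_zero,
        Nat.succ_ne_zero, or_self]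
      have : 2 * (l + 1) * d = 2 * l * d + d + d := by ring
      omega
  · have h1 : (2 * l + 1) % 2 ≠ 0 := by omega
    have h2 : (2 * l + 1 + 1) % 2 = 0 := by omega
    simp only [h1, h2, if_false, if_true, Nat.succ_ne_zero, Nat.add_sub_cancel]
    have : (2 * l + 1 + 1) * d = 2 * l * d + d + d := by ring
    omega

/-- The projection that couples the pairs of coordinates `2 l`, `2 l + 1` at the places where both
positions are `0`, and the pairs `2 l + 1`, `2 l + 2` where both are maximal. -/
noncomputable def coupling (d d' π π' : ℕ) : SeqSpace →L[ℝ] SeqSpace :=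
  if π = 0 ∧ π' = 0 then halfDifference swapEven
  else if π = d ∧ π' = d' then halfDifference swapOdd else 0

theorem isOrthogonalProjection_coupling (d d' π π' : ℕ) :
    IsOrthogonalProjection (coupling d d' π π') := by
  unfold coupling
  split_ifs
  · exact isOrthogonalProjection_halfDifference swapEven_swapEven
  · exact isOrthogonalProjection_halfDifference swapOdd_swapOdd
  · exact ⟨fun x y => by simp, fun x => by simp⟩

theorem coupling_apply_eq_zero {d d' π π' : ℕ} {τ : ℕ → ℕ} {w : ℕ}
    (h1 : π = 0 → π' = 0 → ∀ j, τ j ≤ τ (swapEven j) + w)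
    (h2 : π = d → π' = d' → ∀ j, τ j ≤ τ (swapOdd j) + w) {K : ℕ} {u : SeqSpace}
    (hu : ∀ j, K < τ j → u j = 0) {j : ℕ} (hj : K + w < τ j) : coupling d d' π π' u j = 0 := by
  unfold coupling
  split_ifs with h h'
  · have := h1 h.1 h.2 j
    rw [halfDifference_apply, hu j (by omega), hu (swapEven j) (by omega)]; simp
  · have := h2 h'.1 h'.2 j
    rw [halfDifference_apply, hu j (by omega), hu (swapOdd j) (by omega)]; simp
  · rfl

end Levels

/-! ### The geometric solution of the tridiagonal system -/

section Geometric

theorem memlp_geometric (R : ℝ) {t : ℝ} (ht0 : 0 ≤ t) (ht1 : t < 1) :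
    Memℓp (E := fun _ : ℕ => ℝ) (fun j => R * t ^ j) 2 := by
  rw [memℓp_gen_iff (by norm_num)]
  have h : Summable fun j : ℕ => R ^ 2 * (t ^ 2) ^ j :=
    (summable_geometric_of_lt_one (by positivity) (by nlinarith)).mul_left _
  refine h.congr fun j => ?_
  simp only [ENNReal.toReal_ofNat, Real.rpow_ofNat, Real.norm_eq_abs, sq_abs]
  ring

/-- The sequence `R, R t, R t², …`. -/
noncomputable def geometricSeq (R : ℝ) {t : ℝ} (ht0 : 0 ≤ t) (ht1 : t < 1) : SeqSpace :=
  ⟨fun j => R * t ^ j, memlp_geometric R ht0 ht1⟩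

theorem geometricSeq_apply (R : ℝ) {t : ℝ} (ht0 : 0 ≤ t) (ht1 : t < 1) (j : ℕ) :
    geometricSeq R ht0 ht1 j = R * t ^ j := rfl

/-- A geometric sequence solves the tridiagonal system given by the two couplings. -/
theorem geometricSeq_stationary (R : ℝ) {t β : ℝ} (ht0 : 0 ≤ t) (ht1 : t < 1)
    (ht : (1 - t) ^ 2 = β * t) :
    (β / 2) • geometricSeq R ht0 ht1 + (halfDifference swapEven (geometricSeq R ht0 ht1) +
      halfDifference swapOdd (geometricSeq R ht0 ht1)) =
      lp.single 2 0 (R * (β / 2 + (1 - t) / 2)) := by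
  ext j
  rw [lp.coeFn_add, lp.coeFn_add, Pi.add_apply, Pi.add_apply, lp.coeFn_smul, Pi.smul_apply,
    halfDifference_apply, halfDifference_apply, smul_eq_mul, swapEven_apply, swapOdd_apply]
  simp only [geometricSeq_apply]
  rcases j with _ | j
  -- At coordinate `0` only `swapEven` contributes, since `swapOdd` fixes `0`; this yields the
  -- right-hand side.
  · simp; ring
  -- The two involutions send a positive index to its two neighbours, in an order that depends on
  -- parity.
  · have hsum : R * t ^ (if (j + 1) % 2 = 0 then j + 1 + 1 else j + 1 - 1) +
        R * t ^ (if j + 1 = 0 then 0 else if (j + 1) % 2 = 0 then j + 1 - 1 else j + 1 + 1) =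
          R * t ^ j * (1 + t ^ 2) := by
      split_ifs <;> simp_all <;> ring
    rw [lp.single_apply_ne _ _ _ (Nat.succ_ne_zero j)]
    have h2 : β / 2 * (R * t ^ (j + 1)) + R * t ^ (j + 1) =
        R * t ^ j * (1 + t ^ 2) / 2 := by
      rw [pow_succ]
      linear_combination (-(R * t ^ j) / 2) * ht
    linear_combination h2 - hsum / 2

end Geometric

/-! ### Optimality of the consensus vector -/

section Solution

variable {n m : ℕ} {T φ : Fin m → SeqSpace →L[ℝ] SeqSpace}
  {q : Fin n → Fin m → SeqSpace →L[ℝ] SeqSpace}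

/-- If all blocks of a vector are equal and the sum of the blocks of all gradients vanishes, then
it is a solution. -/
theorem blockProblem_isSolution (h : IsBlockSystem T φ) (hn : 0 < n) (hm : 0 < m)
    {D S : Matrix (Fin m) (Fin m) ℝ} (hS : Dᵀ * D = S)
    (hker : ∀ v : Fin m → ℝ, S *ᵥ v = 0 ↔ ∀ i j, v i = v j) {μ L c : ℝ} (hμ : 0 ≤ μ)
    (hμL : μ ≤ L) (hq : ∀ i p, IsOrthogonalProjection (q i p)) (z : SeqSpace)
    (hz : ∑ i, ∑ p, (μ • z + (L - μ) • q i p z - lp.single 2 0 c) = 0) :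
    (blockProblem T φ q D μ L c).IsSolution fun _ => ∑ p, T p z := by
  have hfeas : blockMatrix T φ D (∑ p, T p z) = 0 := by
    rw [blockMatrix_apply]
    refine Finset.sum_eq_zero fun p _ => ?_
    -- `S = Dᵀ * D` kills the constants, and `Dᵀ * D` and `D` have the same kernel.
    have h1 : D *ᵥ (fun _ => (1 : ℝ)) = 0 := by
      rw [← Matrix.conjTranspose_mul_self_mulVec_eq_zero, Matrix.conjTranspose_eq_transpose_of_trivial,
        hS, hker]
      exact fun _ _ => rfl
    have h2 := congrFun h1 p
    simp only [Matrix.mulVec, dotProduct, mul_one, Pi.zero_apply] at h2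
    simp only [h.apply_sum fun _ => z]
    rw [← Finset.sum_smul, h2, zero_smul, map_zero]
  refine ⟨⟨fun _ => hfeas, fun _ _ => rfl⟩, fun y ⟨hy, hcons⟩ => ?_⟩
  set x := ∑ p, T p z with hx
  let i0 : Fin n := ⟨0, hn⟩
  -- A feasible direction has equal blocks, so only the sum of the blocks of the gradients is tested
  -- against it.
  have hd : ∀ p p', φ p (y i0 - x) = φ p' (y i0 - x) := by
    have h1 : ∀ p p', φ p (y i0) = φ p' (y i0) := by
      intro p p'
      ext j
      refine (hker fun p => φ p (y i0) j).mp ?_ p p'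
      have h2 : blockMatrix T φ S (y i0) = 0 := by
        have h3 : blockMatrix T φ D (y i0) = 0 := hy i0
        rw [← hS, h.blockMatrix_mul_apply, h3, map_zero]
      ext p
      have h3 := h.coord_blockMatrix S p (y i0)
      rw [h2, map_zero] at h3
      have h4 := congrArg (fun u : SeqSpace => u j) h3
      simp only [lp.coeFn_sum, Finset.sum_apply, lp.coeFn_smul, Pi.smul_apply, smul_eq_mul] at h4
      simpa [Matrix.mulVec, dotProduct] using h4.symm
    intro p p'
    rw [map_sub, map_sub, h1 p p', hx, h.apply_sum fun _ => z, h.apply_sum fun _ => z]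
  have hQ := fun i => h.isOrthogonalProjection_blockDiagonal (hq i)
  have hf : ∀ i, (blockProblem T φ q D μ L c).f i x + inner ℝ
      (twoValued (blockDiagonal T φ (q i)) μ L x - ∑ p, T p (lp.single 2 0 c)) (y i0 - x) ≤
        (blockProblem T φ q D μ L c).f i (y i) := by
    intro i
    have h1 := quadratic_eq ((hQ i).twoValued_symm μ L) (∑ p, T p (lp.single 2 0 c)) x (y i0)
    have h2 := (hQ i).le_inner_twoValued hμL (y i0 - x)
    have h3 : 0 ≤ μ * ‖y i0 - x‖ ^ 2 := by positivity
    rw [hcons i i0]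
    change quadratic _ _ _ + _ ≤ quadratic _ _ _
    linarith
  have hg : ∑ i, inner ℝ (twoValued (blockDiagonal T φ (q i)) μ L x -
      ∑ p, T p (lp.single 2 0 c)) (y i0 - x) = 0 := by
    have h1 : ∀ i, twoValued (blockDiagonal T φ (q i)) μ L x - ∑ p, T p (lp.single 2 0 c) =
        ∑ p, T p (μ • z + (L - μ) • q i p z - lp.single 2 0 c) := by
      intro i
      rw [twoValued_apply, blockDiagonal_apply]
      simp only [map_sub, map_add, map_smul, Finset.sum_sub_distrib, Finset.sum_add_distrib,
        ← Finset.smul_sum]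
      rw [hx]
      simp only [h.apply_sum fun _ => z]
    let p0 : Fin m := ⟨0, hm⟩
    have h2 : ∀ i, inner ℝ (∑ p, T p (μ • z + (L - μ) • q i p z - lp.single 2 0 c)) (y i0 - x) =
        inner ℝ (∑ p, (μ • z + (L - μ) • q i p z - lp.single 2 0 c)) (φ p0 (y i0 - x)) := by
      intro i
      rw [sum_inner, sum_inner]
      exact Finset.sum_congr rfl fun p _ => by rw [h.inner_eq, hd p p0]
    simp only [h1, h2]
    rw [← sum_inner, hz, inner_zero_left]
  have := Finset.sum_le_sum fun i (_ : i ∈ Finset.univ) => hf i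
  rw [Finset.sum_add_distrib, hg, add_zero] at this
  exact this

/-- The sum of all couplings. -/
theorem sum_coupling {d d' : ℕ} {G : SimpleGraph (Fin n)} {G' : SimpleGraph (Fin m)}
    {pos : Fin n → ℕ} {pos' : Fin m → ℕ} (hp : IsProfile G d pos) (hp' : IsProfile G' d' pos')
    (z : SeqSpace) :
    ∑ i, ∑ p, coupling d d' (pos i) (pos' p) z =
      (((Finset.univ.filter fun i => pos i = 0).card *
        (Finset.univ.filter fun p => pos' p = 0).card : ℕ) : ℝ) •
        (halfDifference swapEven z + halfDifference swapOdd z) := by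
  have hd0 : d ≠ 0 := by have := hp.one_le; omega
  have h : ∀ i p, coupling d d' (pos i) (pos' p) z =
      (if pos i = 0 then if pos' p = 0 then halfDifference swapEven z else 0 else 0) +
        if pos i = d then if pos' p = d' then halfDifference swapOdd z else 0 else 0 := by
    intro i p
    unfold coupling
    by_cases h1 : pos i = 0
    · have h2 : pos i ≠ d := by omega
      by_cases h3 : pos' p = 0 <;> simp [h1, h3, show (0 : ℕ) ≠ d by omega]
    · by_cases h2 : pos i = d <;> by_cases h3 : pos' p = d' <;> simp [h1, h2, h3, hd0]
  have hsum : ∀ (a b : ℕ) (u : SeqSpace), (∑ i : Fin n, ∑ p : Fin m,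
      if pos i = a then if pos' p = b then u else 0 else 0) =
      (((Finset.univ.filter fun i => pos i = a).card *
        (Finset.univ.filter fun p => pos' p = b).card : ℕ) : ℝ) • u := by
    intro a b u
    have h1 : ∀ i, (∑ p : Fin m, if pos i = a then if pos' p = b then u else 0 else 0) =
        if pos i = a then (Finset.univ.filter fun p => pos' p = b).card • u else 0 := by
      intro i
      split_ifs
      · rw [← Finset.sum_filter, Finset.sum_const]
      · simp
    rw [Finset.sum_congr rfl fun i _ => h1 i, ← Finset.sum_filter, Finset.sum_const, smul_smul,
      Nat.cast_smul_eq_nsmul]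
  simp only [h, Finset.sum_add_distrib, hsum]
  rw [← hp.card_eq, ← hp'.card_eq, smul_add]

end Solution

/-! ### The decay rate and the step count -/

section Numerics

/-- Dividing by `e^{-s}` turns the equation into `4 sinh² (s / 2) = β`, and `y ≤ sinh y` gives `s² ≤
β`. -/
theorem exists_rate {β : ℝ} (hβ : 0 < β) :
    ∃ s : ℝ, 0 < s ∧ s ^ 2 ≤ β ∧ (1 - Real.exp (-s)) ^ 2 = β * Real.exp (-s) := by
  have h0 : 0 < Real.sqrt β := Real.sqrt_pos.mpr hβ
  set y := Real.arsinh (Real.sqrt β / 2) with hy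
  have hy0 : 0 < y := Real.arsinh_pos_iff.mpr (by positivity)
  have hsinh : Real.sinh y = Real.sqrt β / 2 := Real.sinh_arsinh _
  have hle : y ≤ Real.sqrt β / 2 := hsinh ▸ Real.self_le_sinh_iff.mpr hy0.le
  have hsq : Real.sqrt β ^ 2 = β := Real.sq_sqrt hβ.le
  refine ⟨2 * y, by positivity, by nlinarith, ?_⟩
  have h1 : Real.exp (-(2 * y)) = Real.exp (-y) ^ 2 := by
    rw [← Real.exp_nat_mul]; congr 1; push_cast; ring
  have h2 : Real.exp y * Real.exp (-y) = 1 := by rw [← Real.exp_add]; simp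
  have h3 : β = (Real.exp y - Real.exp (-y)) ^ 2 := by
    rw [Real.sinh_eq] at hsinh
    rw [← hsq]
    have : Real.exp y - Real.exp (-y) = Real.sqrt β := by linarith
    rw [this]
  rw [h1, h3]
  linear_combination (-1 - Real.exp y * Real.exp (-y) + 2 * Real.exp (-y) ^ 2) * h2

/-- If the error is at least `(e^{2s - sj})²` as long as fewer than `(j - 1) d` steps have been
made, then the number of steps is at least of order `d log (1 / ε) / s`. -/
theorem mul_log_le_of_forall_error_le {s ε : ℝ} {K d : ℕ} (hs : 0 < s) (hε : 0 < ε) (hd : 1 ≤ d)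
    (h : ∀ j : ℕ, K < (j - 1) * d → (Real.exp (2 * s) * Real.exp (-s) ^ j) ^ 2 ≤ ε) :
    d * Real.log (1 / ε) ≤ 2 * s * K := by
  -- The first index that is certainly still missing. The factor `e^{2s}` absorbs the shift by `2`,
  -- leaving `e^{-2s ⌊K/d⌋} ≤ ε` with no additive loss for `ε` near `1`.
  have h1 := h (K / d + 2) (by
    have := Nat.lt_div_mul_add (a := K) hd
    have h2 : K / d + 2 - 1 = K / d + 1 := Nat.add_sub_cancel (n := K / d + 1) (m := 1)
    rw [h2, add_mul, one_mul]; exact this)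
  rw [← Real.exp_nat_mul, ← Real.exp_add, ← Real.exp_nat_mul, ← Real.le_log_iff_exp_le hε] at h1
  push_cast at h1
  have h2 : ((K / d : ℕ) : ℝ) * d ≤ K := by exact_mod_cast Nat.div_mul_le_self K d
  have h3 : Real.log (1 / ε) ≤ 2 * s * ((K / d : ℕ) : ℝ) := by
    rw [one_div, Real.log_inv]; linarith
  calc d * Real.log (1 / ε) ≤ d * (2 * s * ((K / d : ℕ) : ℝ)) := by gcongr
    _ = 2 * s * (((K / d : ℕ) : ℝ) * d) := by ring
    _ ≤ 2 * s * K := by gcongr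

end Numerics

/-! ### The hard problem and the final constants -/

theorem IsGossipMatrix.exists_transpose_mul_self {n : ℕ} {G : SimpleGraph (Fin n)}
    {W : Matrix (Fin n) (Fin n) ℝ} (hW : IsGossipMatrix G W) :
    ∃ D : Matrix (Fin n) (Fin n) ℝ, Dᵀ * D = W := by
  open scoped MatrixOrder in
  obtain ⟨D, hD⟩ := CStarAlgebra.nonneg_iff_eq_star_mul_self.mp hW.posSemidef.nonneg
  exact ⟨D, hD.symm⟩

theorem IsGossipMatrix.zero_mem_spectrum {n : ℕ} {G : SimpleGraph (Fin n)}
    {W : Matrix (Fin n) (Fin n) ℝ} (hW : IsGossipMatrix G W) (hn : 0 < n) :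
    (0 : ℝ) ∈ spectrum ℝ W := by
  rw [Matrix.mem_spectrum_iff_exists_mulVec]
  refine ⟨fun _ => 1, fun h => by simpa using congrFun h ⟨0, hn⟩, ?_⟩
  rw [zero_smul, hW.kernel]
  exact fun _ _ => rfl

theorem IsProfile.levelThreshold_le {n d : ℕ} {G : SimpleGraph (Fin n)} {pos : Fin n → ℕ}
    (hp : IsProfile G d pos) {i i' : Fin n} (h : G.Adj i i' ∨ i = i') (j : ℕ) :
    levelThreshold d (pos i) j ≤ levelThreshold d (pos i') j + 1 := by
  rcases h with h | rfl
  · exact levelThreshold_le_add_one (hp.adj _ _ h) (hp.adj _ _ h.symm) j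
  · omega

/-- The lower bounds in terms of the distances `d` and `d'` and of the rate `s`. -/
theorem exists_hard_problem {n m d d' : ℕ} {G : SimpleGraph (Fin n)} {G' : SimpleGraph (Fin m)}
    {pos : Fin n → ℕ} {pos' : Fin m → ℕ} (hp : IsProfile G d pos) (hp' : IsProfile G' d' pos')
    {S : Matrix (Fin m) (Fin m) ℝ} (hS : IsGossipMatrix G' S) {μ L : ℝ} (hμ : 0 < μ) (hμL : μ < L)
    (x0 : Fin n → SeqSpace) :
    ∃ P : DecentralizedProblem n,
      (∀ i, IsStronglyConvex μ (P.f i) ∧ IsLSmooth L (P.f i)) ∧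
      spectrum ℝ P.gramA = spectrum ℝ S ∧
      ∃ xstar : SeqSpace, P.IsSolution (fun _ => xstar) ∧
      ∃ s : ℝ, 0 < s ∧ s ^ 2 ≤ 18 * μ / (L - μ) ∧
        ∀ (R : P.AlgorithmRun G x0) (ε : ℝ) (k : ℕ), 0 < ε → (∀ i, ‖R.x k i - xstar‖ ^ 2 ≤ ε) →
          Real.log (1 / ε) ≤ 2 * s * R.numSteps .localComputation k ∧
          d * Real.log (1 / ε) ≤ 2 * s * R.numSteps .communication k ∧
          d' * Real.log (1 / ε) ≤ 2 * s * R.numSteps .multiplication k := by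
  obtain ⟨D, hD⟩ := hS.exists_transpose_mul_self
  obtain ⟨T, φ, h, hx0⟩ := exists_isBlockSystem m x0
  set a := (Finset.univ.filter fun i => pos i = 0).card with ha
  set b := (Finset.univ.filter fun p => pos' p = 0).card with hb
  have hna : (n : ℝ) ≤ 3 * a := by exact_mod_cast hp.card_le
  have hmb : (m : ℝ) ≤ 3 * b := by exact_mod_cast hp'.card_le
  have hn0 : (0 : ℝ) < n := by exact_mod_cast hp.card_pos
  have hm0 : (0 : ℝ) < m := by exact_mod_cast hp'.card_pos
  have ha0 : (0 : ℝ) < a := by linarith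
  have hb0 : (0 : ℝ) < b := by linarith
  have hν : 0 < L - μ := by linarith
  -- Summed over all `n m` places, the stationarity condition has the coefficient `n m μ` at `z` and
  -- `(L - μ) a b` at the two couplings; dividing by the latter leaves `β / 2`.
  set β := 2 * (n * m) * μ / ((L - μ) * (a * b)) with hβ
  obtain ⟨s, hs, hsβ, hrate⟩ := exists_rate (β := β) (by positivity)
  set t := Real.exp (-s) with ht
  have ht1 : t < 1 := by
    rw [ht, ← Real.exp_zero]; exact Real.exp_lt_exp.mpr (by linarith)
  have ht0 : 0 ≤ t := (Real.exp_pos _).le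
  set z := geometricSeq (Real.exp (2 * s)) ht0 ht1 with hz
  -- The source strength that matches the boundary value in `geometricSeq_stationary`, shared among
  -- the `n m` places.
  set c := (L - μ) * (a * b) / (n * m) * (Real.exp (2 * s) * (β / 2 + (1 - t) / 2)) with hc
  let q : Fin n → Fin m → SeqSpace →L[ℝ] SeqSpace := fun i p => coupling d d' (pos i) (pos' p)
  have hq : ∀ i p, IsOrthogonalProjection (q i p) := fun i p =>
    isOrthogonalProjection_coupling _ _ _ _
  have hQ := fun i => h.isOrthogonalProjection_blockDiagonal (hq i)
  have hstat : ∑ i, ∑ p, (μ • z + (L - μ) • q i p z - lp.single 2 0 c) = 0 := by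
    simp only [Finset.sum_sub_distrib, Finset.sum_add_distrib, ← Finset.smul_sum]
    simp only [q]
    rw [sum_coupling hp hp', ← ha, ← hb]
    have h1 := geometricSeq_stationary (Real.exp (2 * s)) ht0 ht1 hrate
    rw [← hz] at h1
    have h2 : halfDifference swapEven z + halfDifference swapOdd z =
        lp.single 2 0 (Real.exp (2 * s) * (β / 2 + (1 - t) / 2)) - (β / 2) • z := by
      rw [← h1]; abel
    rw [h2, hc]
    simp only [Finset.sum_const, Finset.card_univ, Fintype.card_fin, ← smul_eq_mul (a := _ / _),
      lp.single_smul]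
    simp only [← Nat.cast_smul_eq_nsmul ℝ]
    rw [hβ]
    match_scalars
    · field_simp; ring
    · field_simp; ring
  set xstar := ∑ p, T p z with hxstar
  refine ⟨blockProblem T φ q D μ L c, fun i => ⟨?_, ?_⟩, ?_, xstar,
    blockProblem_isSolution h hp.card_pos hp'.card_pos hD hS.kernel hμ.le hμL.le hq z
      hstat, s, hs, ?_, ?_⟩
  · exact isStronglyConvex_quadratic ((hQ i).twoValued_symm μ L) _
      ((hQ i).le_inner_twoValued hμL.le)
  · exact isLSmooth_quadratic ((hQ i).twoValued_symm μ L) _ ((hQ i).inner_twoValued_le hμL.le)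
  · exact DecentralizedProblem.spectrum_gramA _ h hp.card_pos hD (hS.zero_mem_spectrum hp'.card_pos)
      fun _ => rfl
  · refine hsβ.trans ?_
    rw [hβ, div_le_div_iff₀ (by positivity) hν]
    -- Each extreme position occupies at least a third of the vertices of its graph; hence the
    -- constant `18 = 2 · 9`.
    have h1 : (n : ℝ) * m ≤ 9 * (a * b) := by
      calc (n : ℝ) * m ≤ (3 * a) * (3 * b) := mul_le_mul hna hmb hm0.le (by positivity)
        _ = 9 * (a * b) := by ring
    nlinarith [mul_le_mul_of_nonneg_left h1 (mul_pos hμ hν).le]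
  intro R ε k hε herr
  have key : ∀ (s' : StepKind) (w : StepKind → ℕ) (τ : Fin n → Fin m → ℕ → ℕ) (D' : ℕ),
      (∀ s'', w s'' = if s'' = s' then 1 else 0) → 1 ≤ D' →
      (∀ i p j, (j - 1) * D' ≤ τ i p j) → (∀ i p, τ i p 0 = 0) →
      (∀ i p, pos i = 0 → pos' p = 0 → ∀ j, τ i p j ≤ τ i p (swapEven j) + w .localComputation) →
      (∀ i p, pos i = d → pos' p = d' → ∀ j, τ i p j ≤ τ i p (swapOdd j) + w .localComputation) →
      (∀ i i' p j, G.Adj i i' → τ i p j ≤ τ i' p j + w .communication) →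
      (∀ i p p' j, S p p' ≠ 0 → τ i p j ≤ τ i p' j + w .multiplication) →
      D' * Real.log (1 / ε) ≤ 2 * s * R.numSteps s' k := by
    intro s' w τ D' hw hD' hτ hτ0 heven hodd hcomm hmult
    refine mul_log_le_of_forall_error_le hs hε hD' fun j hj => ?_
    let i : Fin n := ⟨0, hp.card_pos⟩
    let p : Fin m := ⟨0, hp'.card_pos⟩
    have hmem := memory_le_vanishingSubmodule (c := c) h hD hμ hμL.le hq hx0 s' w hw τ hτ0
      (fun i p u K hu j hj => coupling_apply_eq_zero (heven i p) (hodd i p) hu hj) hcomm hmult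
      R.kind k i (R.x_mem k i)
    have h1 : φ p (R.x k i) j = 0 := hmem p j (lt_of_lt_of_le hj (hτ i p j))
    have h2 := h.abs_coord_le p (R.x k i - xstar) j
    rw [map_sub, lp.coeFn_sub, Pi.sub_apply, h1, hxstar, h.apply_sum fun _ => z, zero_sub, abs_neg]
      at h2
    calc (Real.exp (2 * s) * t ^ j) ^ 2 = |z j| ^ 2 := by rw [sq_abs]; rfl
      _ ≤ ‖R.x k i - xstar‖ ^ 2 := pow_le_pow_left₀ (abs_nonneg _) h2 2
      _ ≤ ε := herr i
  refine ⟨?_, ?_, ?_⟩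
  -- Each involution moves an index by at most one, so a local computation reveals at most one new
  -- coordinate.
  · have := key .localComputation (fun s'' => if s'' = .localComputation then 1 else 0)
      (fun _ _ j => j) 1 (fun _ => rfl) le_rfl (fun _ _ j => by omega) (fun _ _ => rfl)
      (fun _ _ _ _ j => by simp only [swapEven_apply, if_true]; split_ifs <;> omega)
      (fun _ _ _ _ j => by simp only [swapOdd_apply, if_true]; split_ifs <;> omega)
      (fun _ _ _ _ _ => by simp) (fun _ _ _ _ _ => by simp)
    simpa using this
  -- Thresholds depend on the agent alone: couplings and multiplications leave them unchanged, and
  -- an edge of `G` changes them by at most one.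
  · exact key .communication (fun s'' => if s'' = .communication then 1 else 0)
      (fun i _ j => levelThreshold d (pos i) j) d (fun _ => rfl) hp.one_le
      (fun i _ j => le_levelThreshold (hp.le i) j) (fun _ _ => rfl)
      (fun i _ hi _ j => by simp only [hi, levelThreshold_swapEven]; omega)
      (fun i _ hi _ j => by simp only [hi, levelThreshold_swapOdd]; omega)
      (fun _ _ _ j hadj => hp.levelThreshold_le (.inl hadj) j) (fun _ _ _ _ _ => by simp)
  -- The same count with the roles of agents and blocks exchanged.
  · exact key .multiplication (fun s'' => if s'' = .multiplication then 1 else 0)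
      (fun _ p j => levelThreshold d' (pos' p) j) d' (fun _ => rfl) hp'.one_le
      (fun _ p j => le_levelThreshold (hp'.le p) j) (fun _ _ => rfl)
      (fun _ p _ hi j => by simp only [hi, levelThreshold_swapEven]; omega)
      (fun _ p _ hi j => by simp only [hi, levelThreshold_swapOdd]; omega)
      (fun _ _ _ _ _ => by simp)
      (fun _ p p' j hne => hp'.levelThreshold_le ((hS.compatible p p').mp hne) j)

theorem theorem1 (κ₀ : ℝ) (hκ₀ : 1 < κ₀) :
    ∃ c : ℝ, 0 < c ∧
      ∀ μF LF χW χA : ℝ, 0 < μF → κ₀ ≤ LF / μF → 1 ≤ χW → 1 ≤ χA →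
        ∃ (n : ℕ) (G : SimpleGraph (Fin n)) (W : Matrix (Fin n) (Fin n) ℝ),
          IsGossipMatrix G W ∧ HasConditionNumber W χW ∧
          ∀ x0 : Fin n → SeqSpace,
            ∃ P : DecentralizedProblem n,
              (∀ i, IsStronglyConvex μF (P.f i) ∧ IsLSmooth LF (P.f i)) ∧
              HasConditionNumber P.gramA χA ∧
              ∃ xstar : SeqSpace, P.IsSolution (fun _ => xstar) ∧
                ∀ (R : P.AlgorithmRun G x0) (ε : ℝ) (k : ℕ), 0 < ε → ε < 1 →
                  (∀ i, ‖R.x k i - xstar‖ ^ 2 ≤ ε) →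
                  c * (Real.sqrt (LF / μF) * Real.log (1 / ε)) ≤
                      (R.numSteps .localComputation k : ℝ) ∧
                  c * (Real.sqrt (LF / μF) * Real.log (1 / ε)) * Real.sqrt χW ≤
                      (R.numSteps .communication k : ℝ) ∧
                  c * (Real.sqrt (LF / μF) * Real.log (1 / ε)) * Real.sqrt χA ≤
                      (R.numSteps .multiplication k : ℝ) := by
  have hκ1 : 0 < κ₀ - 1 := by linarith
  -- This bounds `√(L/μ) s`: its square is at most `18 L / (L - μ)`, which decreases in `L / μ` and
  -- is largest at `L / μ = κ₀`.
  set C := Real.sqrt (18 * κ₀ / (κ₀ - 1)) with hC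
  have hC0 : 0 < C := Real.sqrt_pos.mpr (by positivity)
  -- `32` is the `16` from `√χ ≤ 16 d` times the `2` from `2 * s`.
  refine ⟨1 / (32 * C), by positivity, fun μ L χW χA hμ hL hχW hχA => ?_⟩
  have hκL : κ₀ * μ ≤ L := (le_div_iff₀ hμ).mp hL
  have hμL : μ < L := by nlinarith
  obtain ⟨n, G, W, d, pos, hW, hWχ, hp, hd⟩ := exists_gossip_matrix hχW
  obtain ⟨m, G', S, d', pos', hS, hSχ, hp', hd'⟩ := exists_gossip_matrix hχA
  refine ⟨n, G, W, hW, hWχ, fun x0 => ?_⟩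
  obtain ⟨P, hf, hspec, xstar, hsol, s, hs, hsβ, hbound⟩ :=
    exists_hard_problem hp hp' hS hμ hμL x0
  refine ⟨P, hf, (hasConditionNumber_congr hspec).mpr hSχ, xstar, hsol,
    fun R ε k hε hε1 herr => ?_⟩
  obtain ⟨h1, h2, h3⟩ := hbound R ε k hε herr
  have hlog : 0 ≤ Real.log (1 / ε) := Real.log_nonneg (by rw [le_div_iff₀ hε]; linarith)
  have hsC : Real.sqrt (L / μ) * s ≤ C := by
    refine Real.le_sqrt_of_sq_le ?_
    have hν : 0 < L - μ := by linarith
    rw [mul_pow, Real.sq_sqrt (by linarith)]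
    calc L / μ * s ^ 2 ≤ L / μ * (18 * μ / (L - μ)) := by
          refine mul_le_mul_of_nonneg_left hsβ (by linarith)
      _ = 18 * L / (L - μ) := by field_simp
      _ ≤ 18 * κ₀ / (κ₀ - 1) := by
          rw [div_le_div_iff₀ hν hκ1]; nlinarith
  have main : ∀ (D X K : ℝ), 0 ≤ K → X ≤ 16 * D → D * Real.log (1 / ε) ≤ 2 * s * K →
      1 / (32 * C) * (Real.sqrt (L / μ) * Real.log (1 / ε)) * X ≤ K := by
    intro D X K hK hX hDK
    have h4 : Real.sqrt (L / μ) * Real.log (1 / ε) * X ≤ 32 * C * K :=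
      calc Real.sqrt (L / μ) * Real.log (1 / ε) * X
          ≤ Real.sqrt (L / μ) * Real.log (1 / ε) * (16 * D) := by gcongr
        _ = 16 * Real.sqrt (L / μ) * (D * Real.log (1 / ε)) := by ring
        _ ≤ 16 * Real.sqrt (L / μ) * (2 * s * K) := by gcongr
        _ = 32 * (Real.sqrt (L / μ) * s) * K := by ring
        _ ≤ 32 * C * K := by gcongr
    rw [mul_assoc, one_div, inv_mul_le_iff₀ (by positivity)]
    exact h4
  refine ⟨?_, main d _ _ (Nat.cast_nonneg _) hd h2, main d' _ _ (Nat.cast_nonneg _) hd' h3⟩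
  simpa using main 1 1 _ (Nat.cast_nonneg _) (by norm_num) (by simpa using h1)
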